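/- Let $m\ge 2$ and $n\ge 2$ be integers, let $\Omega\subset\mathbb{R}^n$ be a domain (a nonempty connected open set), let $x_0\in\Omega$, and let $u\in C^{2m}(\Omega\setminus\{x_0\})$ be a real-valued solution of the polyharmonic equation $\Delta^m u=0$ in $\Omega\setminus\{x_0\}$. Say that $u$ has a removable singularity at $x_0$ if there exist $\delta>0$ with $\overline{B_\delta(x_0)}\subset\Omega$, where $B_\delta(x_0)=\{x\in\mathbb{R}^n:|x-x_0|<\delta\}$, and a function $v\in C^\infty(B_\delta(x_0))$ with $\Delta^m v=0$ in $B_\delta(x_0)$ such that $u(x)=v(x)$ for all $0<|x-x_0|<\delta$. Then $u$ has a removable singularity at $x_0$ if and only if, for every $k=0,1,\dots,m-1$, $$|\Delta^k u(x)|=\begin{cases} o\big(|x-x_0|^{2-n}\big) & \text{as } x\to x_0,\ x\ne x_0,\ \text{if } n\ge 3,\\[2pt] o\big(\log(1/|x-x_0|)\big) & \text{as } x\to x_0,\ x\ne x_0,\ \text{if } n=2.\end{cases}$$ -/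

import Mathlib

open Set Filter Topology Asymptotics
open scoped ContDiff

/-- The `k`-th power `Δ^k` of the Laplacian of a function on `ℝⁿ`. At a point it depends only on
the values of the function near that point. -/
noncomputable def iteratedLaplacian {n : ℕ} (k : ℕ) (u : EuclideanSpace ℝ (Fin n) → ℝ) :
    EuclideanSpace ℝ (Fin n) → ℝ :=
  Laplacian.laplacian^[k] u

/-- `u` is a classical solution of `Δ^m u = 0` in the (open) set `U`: it is of class `C^(2m)` in
`U`, and `Δ^m u` vanishes at every point of `U`. Values of `u` outside `U` play no role. -/
def IsPolyharmonicOn {n : ℕ} (m : ℕ) (u : EuclideanSpace ℝ (Fin n) → ℝ)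
    (U : Set (EuclideanSpace ℝ (Fin n))) : Prop :=
  ContDiffOn ℝ ((2 * m : ℕ) : ℕ∞) u U ∧ ∀ x ∈ U, iteratedLaplacian m u x = 0

/-- The solution `u` of `Δ^m u = 0` in `Ω \ {x₀}` has a removable singularity at `x₀`: there is a
ball whose closure is contained in `Ω` and a smooth solution `v` of `Δ^m v = 0` in that ball which
coincides with `u` in the ball with the center removed. -/
def HasRemovableSingularity {n : ℕ} (m : ℕ) (u : EuclideanSpace ℝ (Fin n) → ℝ)
    (Ω : Set (EuclideanSpace ℝ (Fin n))) (x₀ : EuclideanSpace ℝ (Fin n)) : Prop :=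
  ∃ δ : ℝ, 0 < δ ∧ closure (Metric.ball x₀ δ) ⊆ Ω ∧
    ∃ v : EuclideanSpace ℝ (Fin n) → ℝ,
      ContDiffOn ℝ ∞ v (Metric.ball x₀ δ) ∧
      IsPolyharmonicOn m v (Metric.ball x₀ δ) ∧
      ∀ x, 0 < ‖x - x₀‖ → ‖x - x₀‖ < δ → u x = v x

/-! A smooth extension has bounded iterated Laplacians near `x₀`, while the fundamental solution
tends to infinity there, so the growth conditions are necessary.

For sufficiency, induct on the order. The function `w = Δ^(m-1) u` is harmonic in a punctured ball
and is `o` of the fundamental solution. It is weakly harmonic across `x₀`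
(`isWeaklyHarmonicOn_ball_of_isLittleO`): multiply a test function by a radial cutoff that vanishes
near `x₀` and is built from truncated potentials of height `N(a)`, where `N(a)` grows at least like
the fundamental solution at radius `√a`. The Laplacian of the cutoff is `1/N(a)` times a difference
of mollifiers of fixed mass, so the growth condition on `w` is what makes the error terms vanish as
`a → 0`.

Weak harmonicity gives the mean value property against radial mollifiers, so `w` is locally a
convolution with such a mollifier. The mollifier is itself `Δ^k` of a smooth radial function, for
any `k`. Convolving `w` with that function yields a smooth `P` with `Δ^(m-1) P = w` near `x₀`
(`exists_iterate_laplacian_eq_of_isWeaklyHarmonicOn`). Then `u - P` solves an equation of order one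
less and satisfies the same growth conditions, since those of `P` are automatic; this closes the
induction in `exists_contDiff_extension_of_isLittleO`. -/

set_option linter.unusedSectionVars false

open Laplacian InnerProductSpace MeasureTheory Convolution

/-! ### Laplacian calculus: product rule, radial functions, integration by parts, convolution. -/

section Calculus

variable {E : Type*} [NormedAddCommGroup E] [InnerProductSpace ℝ E] [FiniteDimensional ℝ E]

theorem ContDiffAt.differentiableAt_fderiv {f : E → ℝ} {x : E} (hf : ContDiffAt ℝ 2 f x) :
    DifferentiableAt ℝ (fderiv ℝ f) x :=
  (hf.fderiv_right (m := 1) (by norm_num)).differentiableAt (by norm_num)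

theorem ContDiffAt.differentiableAt_fderiv_apply {f : E → ℝ} {x : E} (hf : ContDiffAt ℝ 2 f x)
    (v : E) : DifferentiableAt ℝ (fun y => fderiv ℝ f y v) x :=
  hf.differentiableAt_fderiv.clm_apply (differentiableAt_const v)

theorem ContDiffAt.laplacian_eq_sum_fderiv {f : E → ℝ} {x : E} (hf : ContDiffAt ℝ 2 f x)
    {ι : Type*} [Fintype ι] (b : OrthonormalBasis ι ℝ E) :
    Δ f x = ∑ i, fderiv ℝ (fun y => fderiv ℝ f y (b i)) x (b i) := by
  rw [laplacian_eq_iteratedFDeriv_orthonormalBasis f b]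
  refine Finset.sum_congr rfl fun i _ => ?_
  rw [iteratedFDeriv_two_apply, fderiv_clm_apply hf.differentiableAt_fderiv
    (differentiableAt_const _)]
  simp

theorem ContDiffOn.laplacian_of_isOpen {f : E → ℝ} {U : Set E} {r : ℕ∞ω} (hU : IsOpen U)
    (hf : ContDiffOn ℝ (r + 2) f U) : ContDiffOn ℝ r (Δ f) U := by
  let b := stdOrthonormalBasis ℝ E
  have h1 : ContDiffOn ℝ (r + 1) (fderiv ℝ f) U :=
    hf.fderiv_of_isOpen hU (by rw [add_assoc, one_add_one_eq_two])
  have h2 : ContDiffOn ℝ r (fun x => ∑ i, fderiv ℝ (fun y => fderiv ℝ f y (b i)) x (b i)) U := by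
    refine ContDiffOn.sum fun i _ => ?_
    have h3 : ContDiffOn ℝ (r + 1) (fun y => fderiv ℝ f y (b i)) U :=
      h1.clm_apply contDiffOn_const
    exact (h3.fderiv_of_isOpen hU le_rfl).clm_apply contDiffOn_const
  refine h2.congr fun x hx => ?_
  exact ((hf.contDiffAt (hU.mem_nhds hx)).of_le (by simp)).laplacian_eq_sum_fderiv b

theorem ContDiff.laplacian {f : E → ℝ} (hf : ContDiff ℝ ∞ f) : ContDiff ℝ ∞ (Δ f) := by
  rw [← contDiffOn_univ] at *
  exact ContDiffOn.laplacian_of_isOpen isOpen_univ (by simpa using! hf)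

theorem laplacian_eq_zero_of_notMem_tsupport {f : E → ℝ} {x : E} (hx : x ∉ tsupport f) :
    Δ f x = 0 := by
  have h : f =ᶠ[𝓝 x] fun _ => (0 : ℝ) := notMem_tsupport_iff_eventuallyEq.1 hx
  rw [(laplacian_congr_nhds h).eq_of_nhds]
  simp

theorem tsupport_laplacian_subset (f : E → ℝ) : tsupport (Δ f) ⊆ tsupport f :=
  closure_minimal (fun x hx => by
    by_contra h
    exact hx (laplacian_eq_zero_of_notMem_tsupport h)) (isClosed_tsupport f)

theorem HasCompactSupport.laplacian {f : E → ℝ} (hf : HasCompactSupport f) :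
    HasCompactSupport (Δ f) :=
  hf.of_isClosed_subset (isClosed_tsupport _) (tsupport_laplacian_subset f)

theorem ContDiffAt.laplacian_mul {f g : E → ℝ} {x : E} (hf : ContDiffAt ℝ 2 f x)
    (hg : ContDiffAt ℝ 2 g x) {ι : Type*} [Fintype ι] (b : OrthonormalBasis ι ℝ E) :
    Δ (fun y => f y * g y) x = f x * Δ g x + g x * Δ f x
      + 2 * ∑ i, fderiv ℝ f x (b i) * fderiv ℝ g x (b i) := by
  rw [(hf.mul hg).laplacian_eq_sum_fderiv b, hf.laplacian_eq_sum_fderiv b,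
    hg.laplacian_eq_sum_fderiv b, Finset.mul_sum, Finset.mul_sum, Finset.mul_sum,
    ← Finset.sum_add_distrib, ← Finset.sum_add_distrib]
  refine Finset.sum_congr rfl fun i _ => ?_
  have h : (fun y => fderiv ℝ (fun y => f y * g y) y (b i)) =ᶠ[𝓝 x]
      fun y => f y * fderiv ℝ g y (b i) + g y * fderiv ℝ f y (b i) := by
    filter_upwards [hf.eventually (by simp), hg.eventually (by simp)] with y h1 h2
    rw [fderiv_fun_mul (h1.differentiableAt (by norm_num)) (h2.differentiableAt (by norm_num))]
    simp
  have df := hf.differentiableAt (by norm_num)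
  have dg := hg.differentiableAt (by norm_num)
  have df' := hf.differentiableAt_fderiv_apply (b i)
  have dg' := hg.differentiableAt_fderiv_apply (b i)
  rw [h.fderiv_eq, fderiv_fun_add (df.fun_mul dg') (dg.fun_mul df'), fderiv_fun_mul df dg',
    fderiv_fun_mul dg df']
  simp
  ring

theorem hasFDerivAt_comp_normSq_sub {F : ℝ → ℝ} {F' : ℝ} (c x : E)
    (hF : HasDerivAt F F' (‖x - c‖ ^ 2)) :
    HasFDerivAt (fun y => F (‖y - c‖ ^ 2)) ((2 * F') • innerSL ℝ (x - c)) x := by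
  have h1 : HasFDerivAt (fun y : E => ‖y - c‖ ^ 2) (2 • innerSL ℝ (x - c)) x := by
    simpa using! ((hasFDerivAt_id x).sub_const c).norm_sq
  have e : (2 * F') • innerSL ℝ (x - c) = F' • 2 • innerSL ℝ (x - c) := by
    rw [← Nat.cast_smul_eq_nsmul ℝ, smul_smul, mul_comm]
    norm_cast
  rw [e]
  exact hF.comp_hasFDerivAt x h1

theorem contDiff_comp_normSq_sub {F : ℝ → ℝ} {r : ℕ∞ω} (hF : ContDiff ℝ r F) (c : E) :
    ContDiff ℝ r (fun y : E => F (‖y - c‖ ^ 2)) :=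
  hF.comp ((contDiff_id.sub contDiff_const).norm_sq ℝ)

theorem fderiv_comp_normSq_sub {F : ℝ → ℝ} (hF : Differentiable ℝ F) (c x v : E) :
    fderiv ℝ (fun y => F (‖y - c‖ ^ 2)) x v = 2 * deriv F (‖x - c‖ ^ 2) * inner ℝ (x - c) v := by
  rw [(hasFDerivAt_comp_normSq_sub c x (hF _).hasDerivAt).fderiv]
  simp [inner_sub_left]

/-- Profiles are functions of the squared distance, so a smooth profile gives a smooth function even
at the center and the formula needs no exception there. -/
theorem laplacian_comp_normSq_sub {F : ℝ → ℝ} (hF : ContDiff ℝ 2 F) (c x : E) :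
    Δ (fun y => F (‖y - c‖ ^ 2)) x = 4 * ‖x - c‖ ^ 2 * deriv (deriv F) (‖x - c‖ ^ 2)
      + 2 * Module.finrank ℝ E * deriv F (‖x - c‖ ^ 2) := by
  let b := stdOrthonormalBasis ℝ E
  rw [((contDiff_comp_normSq_sub hF c).contDiffAt).laplacian_eq_sum_fderiv b]
  have hF1 : Differentiable ℝ F := hF.differentiable (by norm_num)
  have hF2 : Differentiable ℝ (deriv F) :=
    ((contDiff_succ_iff_deriv (n := 1)).1 (by rwa [one_add_one_eq_two])).2.2.differentiable
      (by norm_num)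
  have key : ∀ i, fderiv ℝ (fun y => fderiv ℝ (fun y => F (‖y - c‖ ^ 2)) y (b i)) x (b i)
      = 4 * deriv (deriv F) (‖x - c‖ ^ 2) * (inner ℝ (x - c) (b i)) ^ 2
        + 2 * deriv F (‖x - c‖ ^ 2) := by
    intro i
    have h1 : (fun y => fderiv ℝ (fun y => F (‖y - c‖ ^ 2)) y (b i))
        = fun y => (2 * deriv F (‖y - c‖ ^ 2)) * inner ℝ (y - c) (b i) := by
      ext y
      exact fderiv_comp_normSq_sub hF1 c y (b i)
    have h2 : HasFDerivAt (fun y : E => inner ℝ (y - c) (b i)) (innerSL ℝ (b i)) x := by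
      have := (innerSL ℝ (b i)).hasFDerivAt.comp x ((hasFDerivAt_id x).sub_const c)
      refine (this.congr_of_eventuallyEq ?_)
      filter_upwards with y
      simp [real_inner_comm]
    have h3 := (hasFDerivAt_comp_normSq_sub c x (hF2 (‖x - c‖ ^ 2)).hasDerivAt).const_mul 2
    rw [h1, (h3.fun_mul h2).fderiv]
    simp [inner_sub_left]
    ring
  rw [Finset.sum_congr rfl fun i _ => key i, Finset.sum_add_distrib, ← Finset.mul_sum,
    b.sum_sq_inner_left]
  simp
  ring

variable [MeasurableSpace E] [BorelSpace E]

theorem integrable_mul_of_tsupport_subset {f g : E → ℝ} {U : Set E} (hU : IsOpen U)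
    (hf : ContinuousOn f U) (hg : ContinuousOn g U) (hc : HasCompactSupport g)
    (hs : tsupport g ⊆ U) : Integrable (fun x => f x * g x) := by
  have hs' : tsupport (fun x => f x * g x) ⊆ U := (tsupport_mul_subset_right).trans hs
  exact ((hf.mul hg).continuous_of_tsupport_subset hU hs').integrable_of_hasCompactSupport
    hc.mul_left

/-- Two integrations by parts in each coordinate direction. Since `ψ` is supported in `U`, the
values of `u` outside `U`, in particular at a singularity, do not matter. -/
theorem integral_mul_laplacian_eq {u ψ : E → ℝ} {U : Set E} (hU : IsOpen U)
    (hu : ContDiffOn ℝ 2 u U) (hψ : ContDiff ℝ 2 ψ) (hc : HasCompactSupport ψ)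
    (hs : tsupport ψ ⊆ U) : ∫ x, u x * Δ ψ x = ∫ x, Δ u x * ψ x := by
  let b := stdOrthonormalBasis ℝ E
  have hu0 : ContinuousOn u U := hu.continuousOn
  have hψ0 : Continuous ψ := hψ.continuous
  have hu1 : ∀ v, ContDiffOn ℝ 1 (fun y => fderiv ℝ u y v) U := fun v =>
    (hu.fderiv_of_isOpen hU (by norm_num)).clm_apply contDiffOn_const
  have hψ1 : ∀ v, ContDiff ℝ 1 (fun y => fderiv ℝ ψ y v) := fun v =>
    (hψ.fderiv_right (by norm_num)).clm_apply contDiff_const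
  have hu2 : ∀ v, ContinuousOn (fun x => fderiv ℝ (fun y => fderiv ℝ u y v) x v) U := fun v =>
    ((hu1 v).continuousOn_fderiv_of_isOpen hU le_rfl).clm_apply continuousOn_const
  have hψ2 : ∀ v, Continuous (fun x => fderiv ℝ (fun y => fderiv ℝ ψ y v) x v) := fun v =>
    ((hψ1 v).continuous_fderiv (by norm_num)).clm_apply continuous_const
  have hc1 : ∀ v, HasCompactSupport (fun y => fderiv ℝ ψ y v) := fun v => hc.fderiv_apply ℝ v
  have hc2 : ∀ v, HasCompactSupport (fun x => fderiv ℝ (fun y => fderiv ℝ ψ y v) x v) :=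
    fun v => (hc1 v).fderiv_apply ℝ v
  have hs1 : ∀ v, tsupport (fun y => fderiv ℝ ψ y v) ⊆ U := fun v =>
    (tsupport_fderiv_apply_subset ℝ v).trans hs
  have hs2 : ∀ v, tsupport (fun x => fderiv ℝ (fun y => fderiv ℝ ψ y v) x v) ⊆ U := fun v =>
    (tsupport_fderiv_apply_subset ℝ v).trans (hs1 v)
  have du : ∀ x ∈ U, DifferentiableAt ℝ u x := fun x hx =>
    (hu.contDiffAt (hU.mem_nhds hx)).differentiableAt (by norm_num)
  have du1 : ∀ v, ∀ x ∈ U, DifferentiableAt ℝ (fun y => fderiv ℝ u y v) x := fun v x hx =>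
    ((hu1 v).contDiffAt (hU.mem_nhds hx)).differentiableAt (by norm_num)
  have key : ∀ v, ∫ x, u x * fderiv ℝ (fun y => fderiv ℝ ψ y v) x v
      = ∫ x, fderiv ℝ (fun y => fderiv ℝ u y v) x v * ψ x := by
    intro v
    have hI := integrable_mul_of_tsupport_subset hU (hu1 v).continuousOn
      (hψ1 v).continuous.continuousOn (hc1 v) (hs1 v)
    rw [integral_mul_fderiv_eq_neg_fderiv_mul_of_integrable (f := u) hI
        (integrable_mul_of_tsupport_subset hU hu0 (hψ2 v).continuousOn (hc2 v) (hs2 v))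
        (integrable_mul_of_tsupport_subset hU hu0 (hψ1 v).continuous.continuousOn (hc1 v) (hs1 v))
        (fun x hx => du x (hs1 v hx))
        (fun x _ => (hψ1 v).differentiable (by norm_num) x),
      integral_mul_fderiv_eq_neg_fderiv_mul_of_integrable (f := fun y => fderiv ℝ u y v) (g := ψ)
        (integrable_mul_of_tsupport_subset hU (hu2 v) hψ0.continuousOn hc hs) hI
        (integrable_mul_of_tsupport_subset hU (hu1 v).continuousOn hψ0.continuousOn hc hs)
        (fun x hx => du1 v x (hs hx)) (fun x _ => hψ.differentiable (by norm_num) x), neg_neg]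
  have e1 : (fun x => u x * Δ ψ x)
      = fun x => ∑ i, u x * fderiv ℝ (fun y => fderiv ℝ ψ y (b i)) x (b i) := by
    ext x
    rw [hψ.contDiffAt.laplacian_eq_sum_fderiv b, Finset.mul_sum]
  have e2 : (fun x => Δ u x * ψ x)
      = fun x => ∑ i, fderiv ℝ (fun y => fderiv ℝ u y (b i)) x (b i) * ψ x := by
    ext x
    by_cases hx : x ∈ U
    · rw [(hu.contDiffAt (hU.mem_nhds hx)).laplacian_eq_sum_fderiv b, Finset.sum_mul]
    · have : ψ x = 0 := image_eq_zero_of_notMem_tsupport fun h => hx (hs h)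
      simp [this]
  rw [e1, e2, integral_finsetSum, integral_finsetSum]
  · exact Finset.sum_congr rfl fun i _ => key (b i)
  · exact fun i _ => integrable_mul_of_tsupport_subset hU (hu2 _) hψ0.continuousOn hc hs
  · exact fun i _ =>
      integrable_mul_of_tsupport_subset hU hu0 (hψ2 _).continuousOn (hc2 _) (hs2 _)

theorem fderiv_convolution_right_apply {f g : E → ℝ} (hf : LocallyIntegrable f)
    (hc : HasCompactSupport g) (hg : ContDiff ℝ 1 g) (x v : E) :
    fderiv ℝ (f ⋆[ContinuousLinearMap.mul ℝ ℝ] g) x v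
      = (f ⋆[ContinuousLinearMap.mul ℝ ℝ] fun y => fderiv ℝ g y v) x := by
  rw [(hc.hasFDerivAt_convolution_right _ hf hg x).fderiv]
  exact convolution_precompR_apply _ hf (hc.fderiv ℝ) (hg.continuous_fderiv one_ne_zero) x v

theorem laplacian_convolution_right {f g : E → ℝ} (hf : LocallyIntegrable f)
    (hc : HasCompactSupport g) (hg : ContDiff ℝ ∞ g) :
    Δ (f ⋆[ContinuousLinearMap.mul ℝ ℝ] g) = f ⋆[ContinuousLinearMap.mul ℝ ℝ] Δ g := by
  let b := stdOrthonormalBasis ℝ E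
  have hg1 : ∀ v, ContDiff ℝ ∞ (fun y => fderiv ℝ g y v) := fun v =>
    (hg.fderiv_right (by norm_num)).clm_apply contDiff_const
  have hg2 : ∀ v, ContDiff ℝ ∞ (fun x => fderiv ℝ (fun y => fderiv ℝ g y v) x v) := fun v =>
    ((hg1 v).fderiv_right (by norm_num)).clm_apply contDiff_const
  have hc1 : ∀ v, HasCompactSupport (fun y => fderiv ℝ g y v) := fun v => hc.fderiv_apply ℝ v
  have hc2 : ∀ v, HasCompactSupport (fun x => fderiv ℝ (fun y => fderiv ℝ g y v) x v) :=
    fun v => (hc1 v).fderiv_apply ℝ v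
  have h1 : (1 : ℕ∞ω) ≤ ∞ := by exact_mod_cast le_top
  have h2 : (2 : ℕ∞ω) ≤ ∞ := WithTop.coe_le_coe.2 (le_top (a := (2 : ℕ∞)))
  ext x
  rw [((hc.contDiff_convolution_right _ hf hg).contDiffAt.of_le h2).laplacian_eq_sum_fderiv b]
  have e : Δ g = fun x => ∑ i, fderiv ℝ (fun y => fderiv ℝ g y (b i)) x (b i) := by
    ext x
    exact (hg.contDiffAt.of_le h2).laplacian_eq_sum_fderiv b
  rw [e]
  simp only [fun y v => fderiv_convolution_right_apply hf hc (hg.of_le h1) y v]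
  simp only [fun v => fderiv_convolution_right_apply hf (hc1 v) ((hg1 v).of_le h1) x v]
  simp only [convolution_def, ContinuousLinearMap.mul_apply', Finset.mul_sum]
  rw [integral_finsetSum]
  intro i _
  exact (hc2 (b i)).convolutionExists_right (ContinuousLinearMap.mul ℝ ℝ) hf
    (hg2 (b i)).continuous x

end Calculus

/-! ### Radial profiles vanishing near the center and their Poisson equation. -/

section RadialProfiles

/-- A smooth monotone step which vanishes on `(-∞, 1]` and equals `1` on `[2, ∞)`. -/
noncomputable def smoothStep (s : ℝ) : ℝ := Real.smoothTransition (s - 1)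

theorem contDiff_smoothStep : ContDiff ℝ ∞ smoothStep :=
  (Real.smoothTransition.contDiff (n := ⊤)).comp (contDiff_id.sub contDiff_const)

theorem smoothStep_eq_zero {s : ℝ} (hs : s ≤ 1) : smoothStep s = 0 :=
  Real.smoothTransition.zero_of_nonpos (by linarith)

theorem smoothStep_eq_one {s : ℝ} (hs : 2 ≤ s) : smoothStep s = 1 :=
  Real.smoothTransition.one_of_one_le (by linarith)

theorem monotone_smoothStep : Monotone smoothStep := fun _ _ h =>
  Real.smoothTransition.monotone (by linarith)

theorem smoothStep_nonneg (s : ℝ) : 0 ≤ smoothStep s := Real.smoothTransition.nonneg _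

theorem smoothStep_le_one (s : ℝ) : smoothStep s ≤ 1 := Real.smoothTransition.le_one _

theorem contDiff_smoothStep_div (a : ℝ) : ContDiff ℝ ∞ fun t => smoothStep (t / a) :=
  contDiff_smoothStep.comp (contDiff_id.div_const a)

theorem smoothStep_div_eq_zero {a s : ℝ} (ha : 0 < a) (hs : s ≤ a) : smoothStep (s / a) = 0 :=
  smoothStep_eq_zero ((div_le_one ha).2 hs)

theorem smoothStep_div_eq_one {a s : ℝ} (ha : 0 < a) (hs : 2 * a ≤ s) : smoothStep (s / a) = 1 :=
  smoothStep_eq_one ((le_div_iff₀ ha).2 hs)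

theorem contDiff_rpow_mul {q : ℝ → ℝ} {s₀ : ℝ} (hs₀ : 0 < s₀) (hq : ContDiff ℝ ∞ q)
    (hq0 : ∀ s ≤ s₀, q s = 0) (p : ℝ) : ContDiff ℝ ∞ fun t => t ^ p * q t := by
  rw [contDiff_iff_contDiffAt]
  intro t
  rcases lt_or_ge t s₀ with h | h
  · have : (fun t => t ^ p * q t) =ᶠ[𝓝 t] fun _ => 0 := by
      filter_upwards [Iio_mem_nhds h] with s hs
      rw [hq0 s (le_of_lt hs), mul_zero]
    exact contDiffAt_const.congr_of_eventuallyEq this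
  · exact (Real.contDiffAt_rpow_const_of_ne (hs₀.trans_le h).ne').mul hq.contDiffAt

/-- The primitive of `t ^ p * q t` which vanishes at the origin. -/
noncomputable def rpowPrimitive (p : ℝ) (q : ℝ → ℝ) (s : ℝ) : ℝ := ∫ t in (0 : ℝ)..s, t ^ p * q t

theorem hasDerivAt_rpowPrimitive {q : ℝ → ℝ} {s₀ : ℝ} (hs₀ : 0 < s₀) (hq : ContDiff ℝ ∞ q)
    (hq0 : ∀ s ≤ s₀, q s = 0) (p s : ℝ) :
    HasDerivAt (rpowPrimitive p q) (s ^ p * q s) s :=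
  (contDiff_rpow_mul hs₀ hq hq0 p).continuous.integral_hasStrictDerivAt 0 s |>.hasDerivAt

theorem deriv_rpowPrimitive {q : ℝ → ℝ} {s₀ : ℝ} (hs₀ : 0 < s₀) (hq : ContDiff ℝ ∞ q)
    (hq0 : ∀ s ≤ s₀, q s = 0) (p : ℝ) : deriv (rpowPrimitive p q) = fun s => s ^ p * q s :=
  funext fun s => (hasDerivAt_rpowPrimitive hs₀ hq hq0 p s).deriv

theorem contDiff_rpowPrimitive {q : ℝ → ℝ} {s₀ : ℝ} (hs₀ : 0 < s₀) (hq : ContDiff ℝ ∞ q)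
    (hq0 : ∀ s ≤ s₀, q s = 0) (p : ℝ) : ContDiff ℝ ∞ (rpowPrimitive p q) := by
  rw [contDiff_infty_iff_deriv, deriv_rpowPrimitive hs₀ hq hq0 p]
  exact ⟨fun s => (hasDerivAt_rpowPrimitive hs₀ hq hq0 p s).differentiableAt,
    contDiff_rpow_mul hs₀ hq hq0 p⟩

theorem rpowPrimitive_eq_zero {q : ℝ → ℝ} {s₀ : ℝ} (hs₀ : 0 < s₀)
    (hq0 : ∀ s ≤ s₀, q s = 0) (p : ℝ) {s : ℝ} (hs : s ≤ s₀) : rpowPrimitive p q s = 0 := by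
  have : EqOn (fun t => t ^ p * q t) (fun _ => (0 : ℝ)) (uIcc 0 s) := by
    intro t ht
    have : t ≤ s₀ := ht.2.trans (max_le hs₀.le hs)
    simp [hq0 t this]
  rw [rpowPrimitive, intervalIntegral.integral_congr this]
  simp

/-- In the variable `s = ‖x - c‖²` the radial Laplacian is `4 s^(1-d/2) (s^(d/2) F')'`, and here
`s^(d/2) F' = q` for `s > 0`. -/
theorem laplacian_rpowPrimitive {E : Type*} [NormedAddCommGroup E] [InnerProductSpace ℝ E]
    [FiniteDimensional ℝ E] {q : ℝ → ℝ} {s₀ : ℝ} (hs₀ : 0 < s₀) (hq : ContDiff ℝ ∞ q)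
    (hq0 : ∀ s ≤ s₀, q s = 0) (c x : E) :
    Δ (fun y => rpowPrimitive (-(Module.finrank ℝ E / 2)) q (‖y - c‖ ^ 2)) x
      = 4 * (‖x - c‖ ^ 2) ^ (1 - Module.finrank ℝ E / 2 : ℝ) * deriv q (‖x - c‖ ^ 2) := by
  set d : ℝ := ((Module.finrank ℝ E : ℕ) : ℝ)
  have h2 : (2 : ℕ∞ω) ≤ ∞ := WithTop.coe_le_coe.2 (le_top (a := (2 : ℕ∞)))
  rw [laplacian_comp_normSq_sub ((contDiff_rpowPrimitive hs₀ hq hq0 _).of_le h2),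
    deriv_rpowPrimitive hs₀ hq hq0]
  set s := ‖x - c‖ ^ 2
  rcases lt_or_ge s s₀ with h | h
  · have e1 : (fun s => s ^ (-(d / 2)) * q s) =ᶠ[𝓝 s] fun _ => 0 := by
      filter_upwards [Iio_mem_nhds h] with t ht
      rw [hq0 t (le_of_lt ht), mul_zero]
    have e2 : q =ᶠ[𝓝 s] fun _ => 0 := by
      filter_upwards [Iio_mem_nhds h] with t ht
      exact hq0 t (le_of_lt ht)
    simp [e1.deriv_eq, e2.deriv_eq, hq0 s h.le]
  · have hs : 0 < s := hs₀.trans_le h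
    have hd : HasDerivAt (fun s => s ^ (-(d / 2)) * q s)
        ((-(d / 2)) * s ^ (-(d / 2) - 1) * q s + s ^ (-(d / 2)) * deriv q s) s :=
      (Real.hasDerivAt_rpow_const (Or.inl hs.ne')).mul
        (hq.differentiable (by simp) s).hasDerivAt
    rw [hd.deriv, Real.rpow_sub_one hs.ne', show (1 - d / 2 : ℝ) = -(d / 2) + 1 by ring,
      Real.rpow_add_one hs.ne']
    field_simp
    ring

/-- Poisson's equation for radial functions which vanish near the center. -/
theorem exists_radial_laplacian_eq (E : Type*) [NormedAddCommGroup E] [InnerProductSpace ℝ E]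
    [FiniteDimensional ℝ E] {f : ℝ → ℝ} {s₀ : ℝ} (hs₀ : 0 < s₀) (hf : ContDiff ℝ ∞ f)
    (hf0 : ∀ s ≤ s₀, f s = 0) :
    ∃ F : ℝ → ℝ, ContDiff ℝ ∞ F ∧ (∀ s ≤ s₀, F s = 0) ∧
      ∀ c x : E, Δ (fun y => F (‖y - c‖ ^ 2)) x = f (‖x - c‖ ^ 2) := by
  set d : ℝ := ((Module.finrank ℝ E : ℕ) : ℝ) with hd
  -- Chosen so that `4 s^(1-d/2) q' = f`.
  let q : ℝ → ℝ := fun s => (1 / 4) * rpowPrimitive (d / 2 - 1) f s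
  have hq : ContDiff ℝ ∞ q := contDiff_const.mul (contDiff_rpowPrimitive hs₀ hf hf0 _)
  have hq0 : ∀ s ≤ s₀, q s = 0 := fun s hs => by
    simp [q, rpowPrimitive_eq_zero hs₀ hf0 _ hs]
  refine ⟨rpowPrimitive (-(d / 2)) q, contDiff_rpowPrimitive hs₀ hq hq0 _,
    fun s hs => rpowPrimitive_eq_zero hs₀ hq0 _ hs, fun c x => ?_⟩
  rw [laplacian_rpowPrimitive hs₀ hq hq0, ← hd]
  set s := ‖x - c‖ ^ 2
  have hq' : deriv q s = (1 / 4) * (s ^ (d / 2 - 1) * f s) :=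
    ((hasDerivAt_rpowPrimitive hs₀ hf hf0 _ s).const_mul (1 / 4)).deriv
  rw [hq']
  rcases le_or_gt s s₀ with h | h
  · simp [hf0 s h]
  · have hs : 0 < s := hs₀.trans h
    have : s ^ (1 - d / 2) * s ^ (d / 2 - 1) = 1 := by
      rw [← Real.rpow_add hs]; simp
    linear_combination f s * this

end RadialProfiles

/-! ### Truncated fundamental solutions and the mollifiers they generate. -/

section Kernels

variable (E : Type*) [NormedAddCommGroup E] [InnerProductSpace ℝ E] [FiniteDimensional ℝ E]

/-- A smooth radial function (of the squared distance) which coincides up to a constant with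
the fundamental solution of the Laplacian away from the center. -/
noncomputable def smoothedPotential (a : ℝ) : ℝ → ℝ :=
  rpowPrimitive (-(Module.finrank ℝ E / 2)) fun t => smoothStep (t / a)

/-- The Laplacian of `smoothedPotential`, a nonnegative radial mollifier. -/
noncomputable def radialMollifier (a s : ℝ) : ℝ :=
  4 * s ^ (1 - Module.finrank ℝ E / 2 : ℝ) * deriv (fun t => smoothStep (t / a)) s

variable {a b : ℝ}

theorem contDiff_smoothedPotential (ha : 0 < a) : ContDiff ℝ ∞ (smoothedPotential E a) :=
  contDiff_rpowPrimitive ha (contDiff_smoothStep_div a) (fun _ => smoothStep_div_eq_zero ha) _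

theorem smoothedPotential_eq_zero (ha : 0 < a) {s : ℝ} (hs : s ≤ a) :
    smoothedPotential E a s = 0 :=
  rpowPrimitive_eq_zero ha (fun _ => smoothStep_div_eq_zero ha) _ hs

theorem hasDerivAt_smoothedPotential (ha : 0 < a) (s : ℝ) :
    HasDerivAt (smoothedPotential E a)
      (s ^ (-(Module.finrank ℝ E / 2) : ℝ) * smoothStep (s / a)) s :=
  hasDerivAt_rpowPrimitive ha (contDiff_smoothStep_div a) (fun _ => smoothStep_div_eq_zero ha) _ _

variable {E} in
theorem laplacian_smoothedPotential (ha : 0 < a) (c x : E) :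
    Δ (fun y => smoothedPotential E a (‖y - c‖ ^ 2)) x = radialMollifier E a (‖x - c‖ ^ 2) :=
  laplacian_rpowPrimitive ha (contDiff_smoothStep_div a) (fun _ => smoothStep_div_eq_zero ha) c x

theorem deriv_smoothStep_div_eq_zero_of_le (ha : 0 < a) {s : ℝ} (hs : s ≤ a) :
    deriv (fun t => smoothStep (t / a)) s = 0 := by
  have hmin : IsMinOn (fun t => smoothStep (t / a)) univ s := fun t _ => by
    simpa [smoothStep_div_eq_zero ha hs] using smoothStep_nonneg (t / a)
  exact (hmin.isLocalMin univ_mem).deriv_eq_zero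

theorem deriv_smoothStep_div_eq_zero_of_ge (ha : 0 < a) {s : ℝ} (hs : 2 * a ≤ s) :
    deriv (fun t => smoothStep (t / a)) s = 0 := by
  have hmax : IsMaxOn (fun t => smoothStep (t / a)) univ s := fun t _ => by
    simpa [smoothStep_div_eq_one ha hs] using smoothStep_le_one (t / a)
  exact (hmax.isLocalMax univ_mem).deriv_eq_zero

theorem radialMollifier_eq_zero_of_le (ha : 0 < a) {s : ℝ} (hs : s ≤ a) :
    radialMollifier E a s = 0 := by
  rw [radialMollifier, deriv_smoothStep_div_eq_zero_of_le ha hs, mul_zero]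

theorem radialMollifier_eq_zero_of_ge (ha : 0 < a) {s : ℝ} (hs : 2 * a ≤ s) :
    radialMollifier E a s = 0 := by
  rw [radialMollifier, deriv_smoothStep_div_eq_zero_of_ge ha hs, mul_zero]

theorem radialMollifier_nonneg (ha : 0 < a) {s : ℝ} (hs : 0 ≤ s) : 0 ≤ radialMollifier E a s := by
  have : Monotone fun t => smoothStep (t / a) := fun x y h =>
    monotone_smoothStep (by gcongr)
  have := this.deriv_nonneg (x := s)
  unfold radialMollifier
  positivity

theorem contDiff_radialMollifier (ha : 0 < a) : ContDiff ℝ ∞ (radialMollifier E a) := by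
  have h := contDiff_rpow_mul ha (contDiff_infty_iff_deriv.1 (contDiff_smoothStep_div a)).2
    (fun s hs => deriv_smoothStep_div_eq_zero_of_le ha hs) (1 - Module.finrank ℝ E / 2 : ℝ)
  have e : radialMollifier E a = fun s => 4 * (s ^ (1 - Module.finrank ℝ E / 2 : ℝ)
      * deriv (fun t => smoothStep (t / a)) s) := by
    ext s
    rw [radialMollifier, mul_assoc]
  rw [e]
  exact contDiff_const.mul h

theorem smoothedPotential_sub_monotoneOn (ha : 0 < a) (hab : a ≤ b) :
    MonotoneOn (fun s => smoothedPotential E a s - smoothedPotential E b s) (Ici 0) := by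
  have hb := ha.trans_le hab
  have hd : ∀ s, HasDerivAt (fun s => smoothedPotential E a s - smoothedPotential E b s) _ s :=
    fun s => (hasDerivAt_smoothedPotential E ha s).sub (hasDerivAt_smoothedPotential E hb s)
  refine monotoneOn_of_deriv_nonneg (convex_Ici 0)
    (fun s _ => (hd s).continuousAt.continuousWithinAt)
    (fun s _ => (hd s).differentiableAt.differentiableWithinAt) fun s hs => ?_
  rw [interior_Ici] at hs
  rw [(hd s).deriv, sub_nonneg]
  have hs' : 0 ≤ s := le_of_lt hs
  gcongr
  exact monotone_smoothStep (by gcongr)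

/-- Past `2a` and `2b` both steps equal `1`, so the two potentials have the same derivative
`s^(-d/2)`. -/
theorem smoothedPotential_sub_eq (ha : 0 < a) (hb : 0 < b) {s t : ℝ} (has : 2 * a ≤ s)
    (hbs : 2 * b ≤ s) (hst : s ≤ t) :
    smoothedPotential E a t - smoothedPotential E b t
      = smoothedPotential E a s - smoothedPotential E b s := by
  have hd : ∀ s, HasDerivAt (fun s => smoothedPotential E a s - smoothedPotential E b s) _ s :=
    fun s => (hasDerivAt_smoothedPotential E ha s).sub (hasDerivAt_smoothedPotential E hb s)
  refine constant_of_derivWithin_zero (f := fun s => smoothedPotential E a s - smoothedPotential E b s)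
    (fun x _ => (hd x).differentiableAt.differentiableWithinAt) (fun x hx => ?_) t ⟨hst, le_rfl⟩
  rw [(hd x).hasDerivWithinAt.derivWithin (uniqueDiffOn_Icc (hx.1.trans_lt hx.2) x ⟨hx.1, hx.2.le⟩),
    smoothStep_div_eq_one ha (has.trans hx.1), smoothStep_div_eq_one hb (hbs.trans hx.1), sub_self]

variable {E}

theorem contDiff_radialMollifier_normSq (ha : 0 < a) (c : E) :
    ContDiff ℝ ∞ fun y : E => radialMollifier E a (‖y - c‖ ^ 2) :=
  contDiff_comp_normSq_sub (contDiff_radialMollifier E ha) c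

theorem hasCompactSupport_of_normSq {f : E → ℝ} (c : E) (r : ℝ)
    (hf : ∀ y, r ≤ ‖y - c‖ ^ 2 → f y = 0) : HasCompactSupport f := by
  refine HasCompactSupport.intro (isCompact_closedBall c (max r 1)) fun x hx => hf x ?_
  rw [Metric.mem_closedBall, dist_eq_norm, not_le, max_lt_iff] at hx
  nlinarith

theorem hasCompactSupport_radialMollifier (ha : 0 < a) (c : E) :
    HasCompactSupport fun y : E => radialMollifier E a (‖y - c‖ ^ 2) :=
  hasCompactSupport_of_normSq c (2 * a) fun _ hy => radialMollifier_eq_zero_of_ge E ha hy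

variable (E) in
/-- The radial test function whose Laplacian is a difference of two mollifiers. -/
noncomputable def potentialGap (a b s : ℝ) : ℝ :=
  smoothedPotential E a s - smoothedPotential E b s
    - (smoothedPotential E a (2 * max a b) - smoothedPotential E b (2 * max a b))

theorem contDiff_potentialGap (ha : 0 < a) (hb : 0 < b) : ContDiff ℝ ∞ (potentialGap E a b) :=
  ((contDiff_smoothedPotential E ha).sub (contDiff_smoothedPotential E hb)).sub contDiff_const

/-- The constant subtracted in `potentialGap` is the value at which the difference stabilizes; this
makes the gap an admissible test function. -/
theorem potentialGap_eq_zero (ha : 0 < a) (hb : 0 < b) {s : ℝ} (hs : 2 * max a b ≤ s) :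
    potentialGap E a b s = 0 := by
  rw [potentialGap, smoothedPotential_sub_eq E ha hb (s := 2 * max a b) _ _ hs, sub_self]
  · gcongr; exact le_max_left a b
  · gcongr; exact le_max_right a b

theorem laplacian_potentialGap (ha : 0 < a) (hb : 0 < b) (c x : E) :
    Δ (fun y => potentialGap E a b (‖y - c‖ ^ 2)) x
      = radialMollifier E a (‖x - c‖ ^ 2) - radialMollifier E b (‖x - c‖ ^ 2) := by
  have h2 : (2 : ℕ∞ω) ≤ ∞ := WithTop.coe_le_coe.2 (le_top (a := (2 : ℕ∞)))
  have hA := (contDiff_comp_normSq_sub (contDiff_smoothedPotential E ha) c).of_le h2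
  have hB := (contDiff_comp_normSq_sub (contDiff_smoothedPotential E hb) c).of_le h2
  have e : (fun y : E => potentialGap E a b (‖y - c‖ ^ 2))
      = ((fun y => smoothedPotential E a (‖y - c‖ ^ 2))
        - (fun y => smoothedPotential E b (‖y - c‖ ^ 2)))
        - (fun _ => smoothedPotential E a (2 * max a b) - smoothedPotential E b (2 * max a b)) :=
    rfl
  have hAB : ContDiffAt ℝ 2 ((fun y => smoothedPotential E a (‖y - c‖ ^ 2))
      - fun y => smoothedPotential E b (‖y - c‖ ^ 2)) x := hA.contDiffAt.sub hB.contDiffAt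
  rw [e, hAB.laplacian_sub contDiffAt_const,
    hA.contDiffAt.laplacian_sub hB.contDiffAt, laplacian_smoothedPotential ha,
    laplacian_smoothedPotential hb]
  simp

variable [MeasurableSpace E] [BorelSpace E]

theorem integral_laplacian_eq_zero {ψ : E → ℝ} (hψ : ContDiff ℝ 2 ψ) (hc : HasCompactSupport ψ) :
    ∫ x, Δ ψ x = 0 := by
  have := integral_mul_laplacian_eq (u := fun _ : E => (1 : ℝ)) isOpen_univ contDiffOn_const hψ hc
    (subset_univ _)
  simpa using this

variable (E) in
/-- The total mass of the mollifiers `radialMollifier`. -/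
noncomputable def mollifierMass : ℝ := ∫ x : E, radialMollifier E 1 (‖x‖ ^ 2)

/-- The difference of two mollifiers is the Laplacian of a compactly supported function, hence has
integral zero. -/
theorem integral_radialMollifier (ha : 0 < a) (c : E) :
    ∫ x : E, radialMollifier E a (‖x - c‖ ^ 2) = mollifierMass E := by
  have h2 : (2 : ℕ∞ω) ≤ ∞ := WithTop.coe_le_coe.2 (le_top (a := (2 : ℕ∞)))
  have h := integral_laplacian_eq_zero
    ((contDiff_comp_normSq_sub (contDiff_potentialGap ha one_pos) c).of_le h2)
    (hasCompactSupport_of_normSq c _ fun _ hy => potentialGap_eq_zero (E := E) ha one_pos hy)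
  have hI : ∀ {r : ℝ}, 0 < r → Integrable fun x : E => radialMollifier E r (‖x - c‖ ^ 2) :=
    fun hr => (contDiff_radialMollifier_normSq hr c).continuous.integrable_of_hasCompactSupport
      (hasCompactSupport_radialMollifier hr c)
  simp only [laplacian_potentialGap ha one_pos] at h
  rw [integral_sub (hI ha) (hI one_pos), sub_eq_zero] at h
  rw [h, mollifierMass, integral_sub_right_eq_self (fun x : E => radialMollifier E 1 (‖x‖ ^ 2)) c]

theorem mollifierMass_pos [Nontrivial E] : 0 < mollifierMass E := by
  have hc := (contDiff_radialMollifier_normSq (E := E) one_pos 0).continuous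
  have hs := hasCompactSupport_radialMollifier (E := E) one_pos 0
  simp only [sub_zero] at hc hs
  rw [mollifierMass]
  -- The step rises from `0` to `1` on `[1, 2]`, so its derivative is nonzero somewhere; the
  -- mollifier is then nonzero on the sphere of radius `√t`.
  obtain ⟨t, ht, hne⟩ : ∃ t ∈ Ioo (1 : ℝ) 2, deriv (fun t => smoothStep (t / 1)) t ≠ 0 := by
    obtain ⟨t, ht, h⟩ := exists_deriv_eq_slope (fun t => smoothStep (t / 1))
      (one_lt_two : (1 : ℝ) < 2) (contDiff_smoothStep_div 1).continuous.continuousOn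
      ((contDiff_smoothStep_div 1).differentiable (by simp)).differentiableOn
    refine ⟨t, ht, ?_⟩
    rw [h, smoothStep_div_eq_zero one_pos le_rfl, smoothStep_div_eq_one one_pos (by norm_num)]
    norm_num
  have ht0 : 0 < t := one_pos.trans ht.1
  obtain ⟨x, hx⟩ := exists_norm_eq E (Real.sqrt_nonneg t)
  refine hc.integral_pos_of_hasCompactSupport_nonneg_nonzero hs
    (fun x => radialMollifier_nonneg E one_pos (by positivity)) (x := x) ?_
  rw [hx, Real.sq_sqrt ht0.le, radialMollifier]
  exact mul_ne_zero (by positivity) hne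

end Kernels

/-! ### Weakly harmonic functions: mean value property and smooth polyharmonic potentials. -/

section WeaklyHarmonic

variable {E : Type*} [NormedAddCommGroup E] [InnerProductSpace ℝ E] [FiniteDimensional ℝ E]

theorem iterate_laplacian_congr_nhds {f g : E → ℝ} {x : E} (h : f =ᶠ[𝓝 x] g) (k : ℕ) :
    Laplacian.laplacian^[k] f =ᶠ[𝓝 x] Laplacian.laplacian^[k] g := by
  induction k generalizing f g with
  | zero => exact h
  | succ k ih => exact ih (laplacian_congr_nhds h)

theorem ContDiff.iterate_laplacian {f : E → ℝ} (hf : ContDiff ℝ ∞ f) (k : ℕ) :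
    ContDiff ℝ ∞ (Laplacian.laplacian^[k] f) := by
  induction k generalizing f with
  | zero => exact hf
  | succ k ih => exact ih hf.laplacian

theorem exists_radial_iterate_laplacian_eq (E : Type*) [NormedAddCommGroup E]
    [InnerProductSpace ℝ E] [FiniteDimensional ℝ E] {f : ℝ → ℝ} {s₀ : ℝ} (hs₀ : 0 < s₀)
    (hf : ContDiff ℝ ∞ f) (hf0 : ∀ s ≤ s₀, f s = 0) (k : ℕ) :
    ∃ F : ℝ → ℝ, ContDiff ℝ ∞ F ∧ (∀ s ≤ s₀, F s = 0) ∧ ∀ c : E,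
      Laplacian.laplacian^[k] (fun y => F (‖y - c‖ ^ 2)) = fun y => f (‖y - c‖ ^ 2) := by
  induction k with
  | zero => exact ⟨f, hf, hf0, fun c => rfl⟩
  | succ k ih =>
    obtain ⟨F, hF, hF0, hFk⟩ := ih
    obtain ⟨G, hG, hG0, hGF⟩ := exists_radial_laplacian_eq E hs₀ hF hF0
    refine ⟨G, hG, hG0, fun c => ?_⟩
    rw [Function.iterate_succ_apply, ← hFk c]
    congr 1
    exact funext fun x => hGF c x

variable [MeasurableSpace E] [BorelSpace E]

/-- `u` is harmonic in `U` in the sense of distributions. -/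
def IsWeaklyHarmonicOn (u : E → ℝ) (U : Set E) : Prop :=
  ∀ ψ : E → ℝ, ContDiff ℝ ∞ ψ → HasCompactSupport ψ → tsupport ψ ⊆ U → ∫ x, u x * Δ ψ x = 0

theorem isWeaklyHarmonicOn_of_laplacian_eq_zero {u : E → ℝ} {U : Set E} (hU : IsOpen U)
    (hu : ContDiffOn ℝ 2 u U) (h0 : ∀ x ∈ U, Δ u x = 0) : IsWeaklyHarmonicOn u U := by
  intro ψ hψ hc hs
  have h2 : (2 : ℕ∞ω) ≤ ∞ := WithTop.coe_le_coe.2 (le_top (a := (2 : ℕ∞)))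
  rw [integral_mul_laplacian_eq hU hu (hψ.of_le h2) hc hs]
  refine integral_eq_zero_of_ae (Eventually.of_forall fun x => ?_)
  by_cases hx : x ∈ U
  · simp [h0 x hx]
  · simp [image_eq_zero_of_notMem_tsupport fun h => hx (hs h)]

theorem MeasureTheory.IntegrableOn.mul_continuous_of_support_subset {u g : E → ℝ} {U : Set E}
    (hu : IntegrableOn u U) (hU : MeasurableSet U) (hg : Continuous g) (hc : HasCompactSupport g)
    (hs : Function.support g ⊆ U) : Integrable fun x => u x * g x := by
  obtain ⟨C, hC⟩ := hg.bounded_above_of_compact_support hc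
  have h := (hu.integrable_indicator hU).mul_bdd hg.aestronglyMeasurable
    (Eventually.of_forall hC)
  refine h.congr (Eventually.of_forall fun x => ?_)
  by_cases hx : x ∈ U
  · simp [hx]
  · have : g x = 0 := by
      by_contra h
      exact hx (hs h)
    simp [this]

theorem support_radialMollifier_subset {a : ℝ} (ha : 0 < a) (c : E) :
    Function.support (fun y : E => radialMollifier E a (‖y - c‖ ^ 2))
      ⊆ {y | a < ‖y - c‖ ^ 2 ∧ ‖y - c‖ ^ 2 < 2 * a} := by
  intro y hy
  constructor
  · by_contra h
    exact hy (radialMollifier_eq_zero_of_le E ha (not_lt.1 h))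
  · by_contra h
    exact hy (radialMollifier_eq_zero_of_ge E ha (not_lt.1 h))

/-- The kernel is nonnegative, has mass `mollifierMass E`, and lives where `‖y - x‖² < 2a`, so this
is an average of `u - u x` over a small ball. -/
theorem abs_integral_radialMollifier_sub_le {u : E → ℝ} {U : Set E} (hU : MeasurableSet U)
    (hu : IntegrableOn u U) {x : E} {a ε : ℝ} (ha : 0 < a)
    (hx : ∀ y, ‖y - x‖ ^ 2 < 2 * a → y ∈ U ∧ |u y - u x| ≤ ε) :
    |(∫ y, u y * radialMollifier E a (‖y - x‖ ^ 2)) - mollifierMass E * u x|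
      ≤ ε * mollifierMass E := by
  have hφ := (contDiff_radialMollifier_normSq ha x).continuous
  have hc := hasCompactSupport_radialMollifier ha x
  have h1 := hu.mul_continuous_of_support_subset hU hφ hc
    fun y hy => (hx y (support_radialMollifier_subset ha x hy).2).1
  have h2 := hφ.integrable_of_hasCompactSupport (μ := volume) hc
  rw [← integral_radialMollifier ha x, ← integral_mul_const, ← integral_const_mul,
    ← integral_sub h1 (h2.mul_const _), ← Real.norm_eq_abs]
  refine norm_integral_le_of_norm_le (h2.const_mul ε) (Eventually.of_forall fun y => ?_)
  have h0 := radialMollifier_nonneg E ha (s := ‖y - x‖ ^ 2) (by positivity)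
  rw [mul_comm (radialMollifier E a _), ← sub_mul, norm_mul, Real.norm_of_nonneg h0,
    Real.norm_eq_abs]
  by_cases hy : ‖y - x‖ ^ 2 < 2 * a
  · gcongr
    exact (hx y hy).2
  · rw [radialMollifier_eq_zero_of_ge E ha (not_lt.1 hy), mul_zero, mul_zero]

/-- Mean value property. Testing against `potentialGap` shows that the weighted integral at scale
`b` equals the one at every smaller scale `a`, and continuity at `x` identifies it as `a → 0`. -/
theorem IsWeaklyHarmonicOn.integral_radialMollifier_eq {u : E → ℝ} {U : Set E} (hU : IsOpen U)
    (hu : IntegrableOn u U) (hw : IsWeaklyHarmonicOn u U) {x : E} (hx : ContinuousAt u x)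
    {b : ℝ} (hb : 0 < b) (hxU : ∀ y, ‖y - x‖ ^ 2 ≤ 2 * b → y ∈ U) [Nontrivial E] :
    ∫ y, u y * radialMollifier E b (‖y - x‖ ^ 2) = mollifierMass E * u x := by
  have hm := mollifierMass_pos (E := E)
  refine eq_of_forall_dist_le fun ε hε => ?_
  rw [Real.dist_eq]
  have hcont : ∀ᶠ y in 𝓝 x, |u y - u x| ≤ ε / mollifierMass E := by
    filter_upwards [Metric.continuousAt_iff'.1 hx _ (div_pos hε hm)] with y hy
    exact (Real.dist_eq _ _ ▸ hy).le
  obtain ⟨δ, hδ, hball⟩ := Metric.eventually_nhds_iff.1 hcont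
  let a : ℝ := min b (δ ^ 2 / 2)
  have ha : 0 < a := lt_min hb (by positivity)
  have hab : a ≤ b := min_le_left _ _
  have hgap := hw _ (contDiff_comp_normSq_sub (contDiff_potentialGap (E := E) ha hb) x)
    (hasCompactSupport_of_normSq x _ fun _ hy => potentialGap_eq_zero (E := E) ha hb hy) (by
      have hclosed : IsClosed {y : E | ‖y - x‖ ^ 2 ≤ 2 * b} :=
        isClosed_le (by fun_prop) continuous_const
      refine (closure_minimal (fun y hy => ?_) hclosed).trans hxU
      by_contra h
      refine hy (potentialGap_eq_zero (E := E) ha hb ?_)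
      rw [max_eq_right hab]
      exact (not_le.1 h).le)
  have hint : ∀ {c : ℝ}, 0 < c → c ≤ b →
      Integrable fun y => u y * radialMollifier E c (‖y - x‖ ^ 2) := fun hc hcb =>
    hu.mul_continuous_of_support_subset hU.measurableSet
      (contDiff_radialMollifier_normSq hc x).continuous (hasCompactSupport_radialMollifier hc x)
      fun y hy => hxU y ((support_radialMollifier_subset hc x hy).2.le.trans (by linarith))
  simp only [laplacian_potentialGap ha hb, mul_sub] at hgap
  rw [integral_sub (hint ha hab) (hint hb le_rfl), sub_eq_zero] at hgap
  rw [← hgap]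
  refine (abs_integral_radialMollifier_sub_le hU.measurableSet hu ha fun y hy =>
    ⟨hxU y (hy.le.trans (by linarith)), hball ?_⟩).trans (by field_simp; rfl)
  rw [dist_eq_norm]
  refine lt_of_pow_lt_pow_left₀ 2 hδ.le (hy.trans_le ?_)
  have : a ≤ δ ^ 2 / 2 := min_le_right _ _
  linarith

/-- `P` is the convolution of `u` with a radial function whose `k`-th Laplacian is the mollifier, so
`Δ^k P` is the weighted mean of `u`. Equality is claimed only at continuity points because `u` may
have an arbitrary value at the singularity. -/
theorem exists_iterate_laplacian_eq_of_isWeaklyHarmonicOn [Nontrivial E] {u : E → ℝ} {x₀ : E}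
    {r R : ℝ} (hr : r < R)
    (hu : IntegrableOn u (Metric.ball x₀ R)) (hw : IsWeaklyHarmonicOn u (Metric.ball x₀ R))
    (k : ℕ) : ∃ P : E → ℝ, ContDiff ℝ ∞ P ∧
      ∀ x ∈ Metric.ball x₀ r, ContinuousAt u x → Laplacian.laplacian^[k] P x = u x := by
  have hm := mollifierMass_pos (E := E)
  -- With this scale `2b < (R - r)²`, so the mollifier centered at a point of the smaller ball stays
  -- inside the larger one.
  let b : ℝ := (R - r) ^ 2 / 4
  have hb : 0 < b := by have : 0 < R - r := sub_pos.2 hr; positivity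
  obtain ⟨F, hF, -, hFk⟩ := exists_radial_iterate_laplacian_eq E hb
    (contDiff_radialMollifier E hb) (fun s hs => radialMollifier_eq_zero_of_le E hb hs) k
  -- `F` need not have compact support. The bump supplies it and equals `1` at every difference of
  -- two points of the balls, so the truncation is invisible to the convolution there.
  let χ : ContDiffBump (0 : E) := ⟨2 * |R| + 1, 2 * |R| + 2, by positivity, by linarith⟩
  let g : E → ℝ := fun y => F (‖y - 0‖ ^ 2) * χ y
  have hg : ContDiff ℝ ∞ g := (contDiff_comp_normSq_sub hF 0).mul χ.contDiff
  have hgc : HasCompactSupport g := χ.hasCompactSupport.mul_left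
  let f : E → ℝ := fun x => (mollifierMass E)⁻¹ * (Metric.ball x₀ R).indicator u x
  have hf : LocallyIntegrable f :=
    ((hu.integrable_indicator measurableSet_ball).const_mul _).locallyIntegrable
  have hiter : ∀ {g : E → ℝ}, ContDiff ℝ ∞ g → HasCompactSupport g →
      Laplacian.laplacian^[k] (f ⋆[ContinuousLinearMap.mul ℝ ℝ] g)
        = f ⋆[ContinuousLinearMap.mul ℝ ℝ] (Laplacian.laplacian^[k] g) := by
    clear hFk
    intro g hg hgc
    induction k generalizing g with
    | zero => rfl
    | succ k ih =>
      rw [Function.iterate_succ_apply, laplacian_convolution_right hf hgc hg,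
        ih hg.laplacian hgc.laplacian, ← Function.iterate_succ_apply]
  refine ⟨f ⋆[ContinuousLinearMap.mul ℝ ℝ] g, hgc.contDiff_convolution_right _ hf hg,
    fun x hx hux => ?_⟩
  rw [hiter hg hgc, convolution_def]
  have hxb : ∀ y, ‖y - x‖ ^ 2 ≤ 2 * b → y ∈ Metric.ball x₀ R := by
    intro y hy
    have h1 : ‖y - x‖ < R - r := by
      refine lt_of_pow_lt_pow_left₀ 2 (sub_pos.2 hr).le (hy.trans_lt ?_)
      simp only [b] at hb ⊢
      linarith
    rw [Metric.mem_ball, dist_eq_norm] at *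
    calc ‖y - x₀‖ ≤ ‖y - x‖ + ‖x - x₀‖ := norm_sub_le_norm_sub_add_norm_sub _ _ _
      _ < R := by linarith
  have key : ∀ t, (ContinuousLinearMap.mul ℝ ℝ) (f t) ((Laplacian.laplacian^[k] g) (x - t))
      = (mollifierMass E)⁻¹ * (u t * radialMollifier E b (‖t - x‖ ^ 2)) := by
    intro t
    by_cases ht : t ∈ Metric.ball x₀ R
    · have hxt : x - t ∈ Metric.ball (0 : E) (2 * |R| + 1) := by
        rw [Metric.mem_ball, dist_eq_norm] at *
        have := le_abs_self R
        calc ‖x - t - 0‖ = ‖(x - x₀) - (t - x₀)‖ := by simp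
          _ ≤ ‖x - x₀‖ + ‖t - x₀‖ := norm_sub_le _ _
          _ < 2 * |R| + 1 := by linarith
      have e : g =ᶠ[𝓝 (x - t)] fun y => F (‖y - 0‖ ^ 2) := by
        filter_upwards [χ.eventuallyEq_one_of_mem_ball hxt] with y hy
        simp [g, hy]
      rw [(iterate_laplacian_congr_nhds e k).eq_of_nhds, hFk]
      simp [f, ht, norm_sub_rev x t, mul_assoc]
    · have : radialMollifier E b (‖t - x‖ ^ 2) = 0 := by
        by_contra h
        exact ht (hxb t (support_radialMollifier_subset hb x h).2.le)
      simp [f, ht, this]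
  simp only [key]
  rw [integral_const_mul, hw.integral_radialMollifier_eq Metric.isOpen_ball hu hux hb hxb]
  field_simp

end WeaklyHarmonic

/-! ### Growth of the fundamental solution, with dimension two and higher dimensions treated
together. -/

section FundamentalProfile

/-- The growth of the fundamental solution of the Laplacian in dimension `d ≥ 2`. -/
noncomputable def fundamentalProfile (d : ℕ) (r : ℝ) : ℝ :=
  if d = 2 then Real.log (1 / r) else r ^ (2 - (d : ℤ))

variable {d : ℕ}

theorem tendsto_fundamentalProfile (hd : 2 ≤ d) :
    Tendsto (fundamentalProfile d) (𝓝[>] 0) atTop := by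
  rcases eq_or_ne d 2 with h | h
  · have : fundamentalProfile d = fun r => Real.log (r⁻¹) := by
      ext r; simp [fundamentalProfile, h]
    rw [this]
    exact Real.tendsto_log_atTop.comp tendsto_inv_nhdsGT_zero
  · obtain ⟨k, rfl⟩ : ∃ k, d = k + 3 := ⟨d - 3, by omega⟩
    have : fundamentalProfile (k + 3) = fun r => (r⁻¹) ^ (k + 1) := by
      ext r
      rw [fundamentalProfile, if_neg h, inv_pow, ← zpow_natCast, ← zpow_neg]
      congr 1
    rw [this]
    exact (tendsto_pow_atTop (by omega)).comp tendsto_inv_nhdsGT_zero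

theorem fundamentalProfile_antitoneOn (hd : 2 ≤ d) : AntitoneOn (fundamentalProfile d) (Ioi 0) := by
  intro r hr s hs hrs
  have hr' : 0 < r := hr
  have hs' : 0 < s := hs
  rcases eq_or_ne d 2 with h | h
  · simp only [fundamentalProfile, h, if_true]
    gcongr
  · obtain ⟨k, rfl⟩ : ∃ k, d = k + 3 := ⟨d - 3, by omega⟩
    have e : ∀ r : ℝ, fundamentalProfile (k + 3) r = (r⁻¹) ^ (k + 1) := by
      intro r
      rw [fundamentalProfile, if_neg h, inv_pow, ← zpow_natCast, ← zpow_neg]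
      congr 1
    rw [e, e]
    gcongr

/-- One power bound for both the logarithm and `r^(2-d)`. The exponent `3/2 - d` leaves room for a
further factor `1/r`: `1/2 - d` is still integrable at the origin. -/
theorem fundamentalProfile_le_rpow (hd : 2 ≤ d) {r : ℝ} (hr : 0 < r) (hr1 : r ≤ 1) :
    fundamentalProfile d r ≤ 2 * r ^ (3 / 2 - d : ℝ) := by
  rcases eq_or_ne d 2 with h | h
  · subst h
    have := Real.log_le_rpow_div (x := 1 / r) (by positivity) (ε := 1 / 2) (by norm_num)
    simp only [fundamentalProfile, if_true]
    refine this.trans (le_of_eq ?_)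
    rw [one_div r, Real.inv_rpow hr.le, ← Real.rpow_neg hr.le]
    norm_num
    ring
  · rw [fundamentalProfile, if_neg h, ← Real.rpow_intCast]
    have h1 : r ^ (((2 - (d : ℤ) : ℤ)) : ℝ) ≤ r ^ (3 / 2 - d : ℝ) := by
      refine Real.rpow_le_rpow_of_exponent_ge hr hr1 ?_
      push_cast
      linarith
    have : 0 ≤ r ^ (3 / 2 - d : ℝ) := by positivity
    linarith

theorem tendsto_sqrt_nhdsGT_zero : Tendsto (fun a : ℝ => √a) (𝓝[>] 0) (𝓝[>] 0) := by
  refine tendsto_nhdsWithin_iff.2 ⟨?_, ?_⟩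
  · simpa using (Real.continuous_sqrt.tendsto 0).mono_left nhdsWithin_le_nhds
  · filter_upwards [self_mem_nhdsWithin] with a ha
    exact Real.sqrt_pos.2 ha

theorem rpow_le_fundamentalProfile_sqrt (hd : 2 ≤ d) :
    ∀ᶠ a in 𝓝[>] (0 : ℝ), a ^ (1 - d / 2 : ℝ) ≤ fundamentalProfile d √a := by
  rcases eq_or_ne d 2 with h | h
  · subst h
    filter_upwards [((tendsto_fundamentalProfile hd).comp tendsto_sqrt_nhdsGT_zero).eventually_ge_atTop 1] with a ha
    simpa using ha
  · filter_upwards [self_mem_nhdsWithin] with a ha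
    have ha' : 0 < a := ha
    rw [fundamentalProfile, if_neg h, ← Real.rpow_intCast, Real.sqrt_eq_rpow,
      ← Real.rpow_mul ha'.le]
    refine le_of_eq ?_
    congr 1
    push_cast
    ring

end FundamentalProfile

/-! ### Radial cutoffs with small Laplacian. -/

section Cutoff

variable (E : Type*) [NormedAddCommGroup E] [InnerProductSpace ℝ E] [FiniteDimensional ℝ E]

/-- The height of the difference of two smoothed potentials. -/
noncomputable def potentialHeight (a : ℝ) : ℝ :=
  smoothedPotential E a 2 - smoothedPotential E 1 2

/-- A radial cutoff, vanishing near the center, with small Laplacian. -/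
noncomputable def radialCutoff (a s : ℝ) : ℝ :=
  1 + (potentialHeight E a)⁻¹ * potentialGap E a 1 s

variable {E} {a : ℝ}

theorem potentialGap_one (ha : a ≤ 1) (s : ℝ) : potentialGap E a 1 s =
    smoothedPotential E a s - smoothedPotential E 1 s - potentialHeight E a := by
  rw [potentialGap, potentialHeight, max_eq_right ha, mul_one]

theorem smoothedPotential_le_potentialHeight (ha : 0 < a) {s : ℝ} (ha1 : a ≤ 1) (hs0 : 0 ≤ s)
    (hs : s ≤ 1) : smoothedPotential E a s ≤ potentialHeight E a := by
  have := smoothedPotential_sub_monotoneOn E ha ha1 (mem_Ici.2 hs0)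
    (mem_Ici.2 (zero_le_two (α := ℝ))) (hs.trans one_le_two)
  simpa [potentialHeight, smoothedPotential_eq_zero E one_pos hs] using this

theorem smoothedPotential_sub_eq_integral (ha : 0 < a) {s : ℝ} (hs : 2 * a ≤ s) :
    smoothedPotential E a s - smoothedPotential E a (2 * a)
      = ∫ t in (2 * a)..s, t ^ (-(Module.finrank ℝ E / 2) : ℝ) := by
  have hd := fun s => hasDerivAt_smoothedPotential E ha s
  have hc := (contDiff_rpow_mul ha (contDiff_smoothStep_div a)
    (fun _ => smoothStep_div_eq_zero ha) (-(Module.finrank ℝ E / 2) : ℝ)).continuous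
  rw [← intervalIntegral.integral_eq_sub_of_hasDerivAt (fun s _ => hd s)
    (hc.intervalIntegrable _ _)]
  refine intervalIntegral.integral_congr fun t ht => ?_
  rw [uIcc_of_le hs] at ht
  simp [smoothStep_div_eq_one ha ht.1]

theorem smoothedPotential_nonneg {s : ℝ} (hs : 0 ≤ s) :
    0 ≤ smoothedPotential E a s := by
  refine intervalIntegral.integral_nonneg hs fun t ht => ?_
  have := smoothStep_nonneg (t / a)
  have := ht.1
  positivity

/-- Calibrates the height against the growth hypothesis. The height dominates the integral of
`t^(-d/2)` over `[2a, 1]` when `d = 2`, which gives the logarithm, and over `[2a, 4a]` otherwise,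
which already gives the power. -/
theorem fundamentalProfile_sqrt_le_potentialHeight (hd : 2 ≤ Module.finrank ℝ E) (ha : 0 < a)
    (ha4 : a ≤ 1 / 4) : fundamentalProfile (Module.finrank ℝ E) √a
      ≤ 4 ^ (Module.finrank ℝ E / 2 : ℝ) / 2 * potentialHeight E a := by
  rcases eq_or_ne (Module.finrank ℝ E) 2 with h | h
  · have h1 := smoothedPotential_le_potentialHeight (E := E) ha (s := 1) (by linarith)
      zero_le_one le_rfl
    have h2 := smoothedPotential_sub_eq_integral (E := E) ha (s := 1) (by linarith)
    have h3 := smoothedPotential_nonneg (E := E) (a := a) (s := 2 * a) (by linarith)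
    have h4 : ∫ t in (2 * a)..1, t ^ (-(((2 : ℕ) : ℝ) / 2) : ℝ) = Real.log (1 / (2 * a)) := by
      rw [← integral_inv_of_pos (by linarith) one_pos]
      norm_num [Real.rpow_neg_one]
    rw [h, h4] at h2
    have h5 : Real.log (1 / (2 * a)) = Real.log (1 / a) - Real.log 2 := by
      rw [← Real.log_div (by positivity) (by norm_num)]
      congr 1
      field_simp
    -- The bound `a ≤ 1/4` is what absorbs the loss of `log 2` caused by starting the integral at
    -- `2a`.
    have h6 : 2 * Real.log 2 ≤ Real.log (1 / a) := by
      rw [show 2 * Real.log 2 = Real.log (2 ^ 2) by rw [Real.log_pow]; norm_num]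
      refine Real.log_le_log (by norm_num) ?_
      rw [le_div_iff₀ ha]
      linarith
    have h7 : fundamentalProfile 2 √a = Real.log (1 / a) / 2 := by
      simp only [fundamentalProfile, if_true, one_div, Real.log_inv, Real.log_sqrt ha.le]
      ring
    have h8 : 0 ≤ Real.log 2 := Real.log_nonneg (by norm_num)
    have h9 : (4 : ℝ) ^ (((2 : ℕ) : ℝ) / 2) / 2 = 2 := by norm_num
    rw [h, h7, h9]
    linarith
  · have h1 := smoothedPotential_le_potentialHeight (E := E) ha (s := 4 * a) (by linarith)
      (by linarith) (by linarith)
    have h2 := smoothedPotential_sub_eq_integral (E := E) ha (s := 4 * a) (by linarith)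
    have h3 := smoothedPotential_nonneg (E := E) (a := a) (s := 2 * a) (by linarith)
    set D : ℝ := ((Module.finrank ℝ E : ℕ) : ℝ) with hD
    have h4 : (4 * a - 2 * a) * (4 * a) ^ (-(D / 2)) ≤ ∫ t in (2 * a)..(4 * a), t ^ (-(D / 2)) := by
      have h5 : IntervalIntegrable (fun t : ℝ => t ^ (-(D / 2))) volume (2 * a) (4 * a) := by
        refine intervalIntegral.intervalIntegrable_rpow (Or.inr ?_)
        rw [uIcc_of_le (by linarith)]
        exact fun h => by linarith [h.1]
      have := intervalIntegral.integral_mono_on (μ := volume) (by linarith)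
        (intervalIntegrable_const (c := (4 * a) ^ (-(D / 2)))) h5 fun t ht =>
          Real.rpow_le_rpow_of_nonpos (by linarith [ht.1]) ht.2
            (by have : 0 ≤ D := by positivity
                linarith)
      simpa using this
    have h5 : fundamentalProfile (Module.finrank ℝ E) √a = a ^ (1 - D / 2) := by
      rw [fundamentalProfile, if_neg h, ← Real.rpow_intCast, Real.sqrt_eq_rpow,
        ← Real.rpow_mul ha.le]
      congr 1
      push_cast
      ring
    have h6 : (4 * a - 2 * a) * (4 * a) ^ (-(D / 2)) = 2 / 4 ^ (D / 2) * a ^ (1 - D / 2) := by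
      rw [Real.mul_rpow (by norm_num) ha.le, sub_eq_add_neg 1, add_comm 1, Real.rpow_add_one ha.ne',
        Real.rpow_neg (by norm_num)]
      field_simp
      ring
    rw [h5]
    have h7 : 2 / 4 ^ (D / 2) * a ^ (1 - D / 2) ≤ potentialHeight E a := by linarith
    have h8 : (0 : ℝ) < 4 ^ (D / 2) := by positivity
    calc a ^ (1 - D / 2) = 4 ^ (D / 2) / 2 * (2 / 4 ^ (D / 2) * a ^ (1 - D / 2)) := by field_simp
      _ ≤ _ := by gcongr

theorem tendsto_potentialHeight (hd : 2 ≤ Module.finrank ℝ E) :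
    Tendsto (potentialHeight E) (𝓝[>] 0) atTop := by
  have h := ((tendsto_fundamentalProfile hd).comp tendsto_sqrt_nhdsGT_zero)
  have hC : (0 : ℝ) < 4 ^ (Module.finrank ℝ E / 2 : ℝ) / 2 := by positivity
  refine (tendsto_const_mul_atTop_of_pos hC).1 (tendsto_atTop_mono' _ ?_ h)
  filter_upwards [Ioc_mem_nhdsGT (show (0 : ℝ) < 1 / 4 by norm_num)] with a ha
  exact fundamentalProfile_sqrt_le_potentialHeight hd ha.1 ha.2

theorem contDiff_radialCutoff (ha : 0 < a) : ContDiff ℝ ∞ (radialCutoff E a) :=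
  contDiff_const.add (contDiff_const.mul (contDiff_potentialGap ha one_pos))

theorem radialCutoff_eq (ha1 : a ≤ 1) (hN : 0 < potentialHeight E a) (s : ℝ) :
    radialCutoff E a s = (potentialHeight E a)⁻¹ *
      (smoothedPotential E a s - smoothedPotential E 1 s) := by
  rw [radialCutoff, potentialGap_one ha1]
  field_simp
  ring

theorem radialCutoff_eq_zero (ha : 0 < a) (ha1 : a ≤ 1) (hN : 0 < potentialHeight E a) {s : ℝ}
    (hs : s ≤ a) : radialCutoff E a s = 0 := by
  rw [radialCutoff_eq ha1 hN, smoothedPotential_eq_zero E ha hs,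
    smoothedPotential_eq_zero E one_pos (hs.trans ha1), sub_self, mul_zero]

theorem radialCutoff_nonneg (ha : 0 < a) (ha1 : a ≤ 1) (hN : 0 < potentialHeight E a) {s : ℝ}
    (hs : 0 ≤ s) : 0 ≤ radialCutoff E a s := by
  rw [radialCutoff_eq ha1 hN]
  have := smoothedPotential_sub_monotoneOn E ha ha1 (mem_Ici.2 le_rfl) (mem_Ici.2 hs) hs
  simp only [smoothedPotential_eq_zero E ha ha.le, smoothedPotential_eq_zero E one_pos zero_le_one,
    sub_self] at this
  positivity

theorem radialCutoff_le_one (ha : 0 < a) (ha1 : a ≤ 1) (hN : 0 < potentialHeight E a) {s : ℝ}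
    (hs : 0 ≤ s) : radialCutoff E a s ≤ 1 := by
  have h : potentialGap E a 1 s ≤ 0 := by
    rcases le_total s 2 with h | h
    · have := smoothedPotential_sub_monotoneOn E ha ha1 (mem_Ici.2 hs)
        (mem_Ici.2 (zero_le_two (α := ℝ))) h
      rw [potentialGap_one ha1, potentialHeight]
      simp only at this
      linarith
    · exact (potentialGap_eq_zero ha one_pos (by rwa [max_eq_right ha1, mul_one])).le
  have := mul_nonpos_of_nonneg_of_nonpos (inv_nonneg.2 hN.le) h
  rw [radialCutoff]
  linarith

theorem deriv_radialCutoff (ha : 0 < a) (s : ℝ) : deriv (radialCutoff E a) s =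
    (potentialHeight E a)⁻¹ * (s ^ (-(Module.finrank ℝ E / 2) : ℝ)
      * (smoothStep (s / a) - smoothStep (s / 1))) := by
  rw [mul_sub]
  exact (((((hasDerivAt_smoothedPotential E ha s).sub
    (hasDerivAt_smoothedPotential E one_pos s)).sub_const _).const_mul _).const_add 1).deriv

theorem laplacian_radialCutoff (ha : 0 < a) (c x : E) :
    Δ (fun y => radialCutoff E a (‖y - c‖ ^ 2)) x = (potentialHeight E a)⁻¹ *
      (radialMollifier E a (‖x - c‖ ^ 2) - radialMollifier E 1 (‖x - c‖ ^ 2)) := by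
  have h2 : (2 : ℕ∞ω) ≤ ∞ := WithTop.coe_le_coe.2 (le_top (a := (2 : ℕ∞)))
  have hG : ContDiffAt ℝ 2 (fun y : E => potentialGap E a 1 (‖y - c‖ ^ 2)) x :=
    ((contDiff_comp_normSq_sub (contDiff_potentialGap ha one_pos) c).of_le h2).contDiffAt
  have e : (fun y : E => radialCutoff E a (‖y - c‖ ^ 2)) = (fun _ => (1 : ℝ))
      + (potentialHeight E a)⁻¹ • fun y : E => potentialGap E a 1 (‖y - c‖ ^ 2) := rfl
  have hG' : ContDiffAt ℝ 2 ((potentialHeight E a)⁻¹ •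
      fun y : E => potentialGap E a 1 (‖y - c‖ ^ 2)) x :=
    hG.const_smul (potentialHeight E a)⁻¹
  rw [e, ContDiffAt.laplacian_add contDiffAt_const hG',
    laplacian_smul _ hG, laplacian_potentialGap ha one_pos]
  simp

theorem tendsto_radialCutoff (hd : 2 ≤ Module.finrank ℝ E) {s : ℝ} (hs : 0 < s) :
    Tendsto (fun a => radialCutoff E a s) (𝓝[>] 0) (𝓝 1) := by
  -- For `a ≤ c` the gap at `s` no longer depends on `a`, whereas the height it is divided by tends
  -- to infinity.
  let c := min (s / 2) 1
  have hc : 0 < c := lt_min (by positivity) one_pos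
  have h0 : Tendsto (fun a => 1 + (potentialHeight E a)⁻¹ * potentialGap E c 1 s) (𝓝[>] 0)
      (𝓝 1) := by
    simpa using ((tendsto_inv_atTop_zero.comp (tendsto_potentialHeight hd)).mul_const
      (potentialGap E c 1 s)).const_add 1
  refine h0.congr' ?_
  filter_upwards [Ioc_mem_nhdsGT hc] with a ha
  have hcs : 2 * c ≤ s := by linarith [min_le_left (s / 2) (1 : ℝ)]
  have hc1 : c ≤ 1 := min_le_right _ _
  have ha1 := ha.2.trans hc1
  have has : 2 * a ≤ s := by linarith [ha.2]
  rw [radialCutoff]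
  congr 2
  rcases le_total s 2 with h | h
  · have := smoothedPotential_sub_eq E ha.1 hc has hcs h
    rw [potentialGap_one ha1, potentialGap_one hc1, potentialHeight, potentialHeight]
    linarith
  · rw [potentialGap_eq_zero ha.1 one_pos (by rwa [max_eq_right ha1, mul_one]),
      potentialGap_eq_zero hc one_pos (by rwa [max_eq_right hc1, mul_one])]

/-- The gradient of the radial factor points along `x - c`, so the cross term is a single
directional derivative of `ψ`. -/
theorem laplacian_mul_comp_normSq_sub {ψ : E → ℝ} {F : ℝ → ℝ} (hψ : ContDiff ℝ 2 ψ)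
    (hF : ContDiff ℝ 2 F) (c x : E) :
    Δ (fun y => ψ y * F (‖y - c‖ ^ 2)) x = ψ x * Δ (fun y => F (‖y - c‖ ^ 2)) x
      + F (‖x - c‖ ^ 2) * Δ ψ x + 4 * deriv F (‖x - c‖ ^ 2) * fderiv ℝ ψ x (x - c) := by
  let b := stdOrthonormalBasis ℝ E
  rw [hψ.contDiffAt.laplacian_mul (contDiff_comp_normSq_sub hF c).contDiffAt b]
  have hs : fderiv ℝ ψ x (x - c) = ∑ i, inner ℝ (x - c) (b i) * fderiv ℝ ψ x (b i) := by
    conv_lhs => rw [← b.sum_repr (x - c), map_sum]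
    refine Finset.sum_congr rfl fun i _ => ?_
    rw [map_smul, b.repr_apply_apply, smul_eq_mul, real_inner_comm]
  rw [hs, Finset.mul_sum, Finset.mul_sum]
  congr 1
  refine Finset.sum_congr rfl fun i _ => ?_
  rw [fderiv_comp_normSq_sub (hF.differentiable (by norm_num))]
  ring

end Cutoff

/-! ### Weak harmonicity across the singular point. -/

section RemovableSingularity

theorem fundamentalProfile_nonneg {d : ℕ} {r : ℝ} (hr : 0 < r) (hr1 : r ≤ 1) :
    0 ≤ fundamentalProfile d r := by
  unfold fundamentalProfile
  split_ifs
  · exact Real.log_nonneg ((one_le_div hr).2 hr1)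
  · positivity

variable {E : Type*} [NormedAddCommGroup E] [InnerProductSpace ℝ E] [FiniteDimensional ℝ E]
  [MeasurableSpace E] [BorelSpace E]

theorem integrableOn_ball_norm_sub_rpow (hd : 1 ≤ Module.finrank ℝ E) {α : ℝ}
    (hα : -(Module.finrank ℝ E : ℝ) < α) (c : E) (r : ℝ) :
    IntegrableOn (fun x => ‖x - c‖ ^ α) (Metric.ball c r) := by
  have h : IntegrableOn (fun x : E => ‖x‖ ^ α) (Metric.ball 0 r) := by
    refine integrableOn_ball_of_norm_le_rpow (C := 1) (α := -α) hd (by linarith)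
      (Eventually.of_forall fun x => ?_)
      (measurable_norm.pow_const α).aestronglyMeasurable
    rw [neg_neg, one_mul, Real.norm_of_nonneg (by positivity)]
  rw [← integrable_indicator_iff measurableSet_ball] at h ⊢
  refine (h.comp_sub_right c).congr (Eventually.of_forall fun x => ?_)
  simp only [indicator, Metric.mem_ball, dist_eq_norm, sub_zero]

/-- The product of `ψ` with the cutoff is supported away from `x₀`, so `u` may be tested against it.
Expanding its Laplacian gives a main term tending to `∫ u Δψ`, a cross term, and two mollifier terms
carrying `1/N(a)`; all but the main term vanish in the limit. -/
theorem isWeaklyHarmonicOn_ball_of_isLittleO (hd : 2 ≤ Module.finrank ℝ E) {u : E → ℝ} {x₀ : E}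
    {r : ℝ} (hu : ContDiffOn ℝ 2 u (Metric.ball x₀ r \ {x₀}))
    (h0 : ∀ x ∈ Metric.ball x₀ r \ {x₀}, Δ u x = 0)
    (ho : u =o[𝓝[≠] x₀] fun x => fundamentalProfile (Module.finrank ℝ E) ‖x - x₀‖)
    (hint : IntegrableOn u (Metric.ball x₀ r))
    (hbd : ∀ x ∈ Metric.ball x₀ r, x ≠ x₀ →
      |u x| ≤ 2 * ‖x - x₀‖ ^ (3 / 2 - Module.finrank ℝ E : ℝ)) :
    IsWeaklyHarmonicOn u (Metric.ball x₀ r) := by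
  intro ψ hψ hc hs
  have : Nontrivial E := Module.nontrivial_of_finrank_pos (R := ℝ) (by omega)
  have h2 : (2 : ℕ∞ω) ≤ ∞ := WithTop.coe_le_coe.2 (le_top (a := (2 : ℕ∞)))
  have hψ2 := hψ.of_le h2
  set D : ℝ := ((Module.finrank ℝ E : ℕ) : ℝ) with hD
  have hD2 : 2 ≤ D := by rw [hD]; exact_mod_cast hd
  let N : ℝ → ℝ := potentialHeight E
  let g : ℝ → ℝ → ℝ := radialCutoff E
  have hΔψc : Continuous (Δ ψ) := hψ.laplacian.continuous
  have hΔψs : Function.support (Δ ψ) ⊆ Metric.ball x₀ r :=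
    (subset_tsupport _).trans ((tsupport_laplacian_subset ψ).trans hs)
  have hDψc : Continuous (fderiv ℝ ψ) := hψ2.continuous_fderiv (by norm_num)
  have hDψs : HasCompactSupport (fderiv ℝ ψ) := hc.fderiv ℝ
  have hNtop : Tendsto N (𝓝[>] 0) atTop := tendsto_potentialHeight hd
  have hNinv : Tendsto (fun a => (N a)⁻¹) (𝓝[>] 0) (𝓝 0) := tendsto_inv_atTop_zero.comp hNtop
  have hsmall : ∀ᶠ a in 𝓝[>] (0 : ℝ), 0 < a ∧ a ≤ 1 / 4 ∧ 0 < N a := by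
    filter_upwards [Ioc_mem_nhdsGT (show (0 : ℝ) < 1 / 4 by norm_num),
      hNtop.eventually_gt_atTop 0] with a ha hN
    exact ⟨ha.1, ha.2, hN⟩
  obtain ⟨C, hC, hCN⟩ : ∃ C : ℝ, 0 ≤ C ∧ ∀ a, 0 < a → a ≤ 1 / 4 →
      fundamentalProfile (Module.finrank ℝ E) √a ≤ C * N a :=
    ⟨_, by positivity, fun a ha ha4 => fundamentalProfile_sqrt_le_potentialHeight hd ha ha4⟩
  obtain ⟨M, hM⟩ := hψ.continuous.bounded_above_of_compact_support hc
  have hM0 : 0 ≤ M := (norm_nonneg _).trans (hM 0)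
  obtain ⟨L, hL⟩ := hDψc.bounded_above_of_compact_support hDψs
  have hL0 : 0 ≤ L := (norm_nonneg _).trans (hL 0)
  have hae : ∀ᵐ x : E, x ≠ x₀ := by
    simp [ae_iff]
  -- integrability of the four terms
  have hg_cont : ∀ {a : ℝ}, 0 < a → Continuous fun x : E => g a (‖x - x₀‖ ^ 2) := fun ha =>
    (contDiff_comp_normSq_sub (contDiff_radialCutoff ha) x₀).continuous
  have hg'_cont : ∀ {a : ℝ}, 0 < a → Continuous fun x : E => deriv (g a) (‖x - x₀‖ ^ 2) :=
    fun ha => (contDiff_comp_normSq_sub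
      (contDiff_infty_iff_deriv.1 (contDiff_radialCutoff ha)).2 x₀).continuous
  have hA_int : ∀ {a : ℝ}, 0 < a →
      Integrable fun x => u x * (g a (‖x - x₀‖ ^ 2) * Δ ψ x) := fun ha =>
    hint.mul_continuous_of_support_subset measurableSet_ball ((hg_cont ha).mul hΔψc)
      hc.laplacian.mul_left ((Function.support_mul_subset_right _ _).trans hΔψs)
  have hB_int : ∀ {a : ℝ}, 0 < a →
      Integrable fun x => u x * (4 * deriv (g a) (‖x - x₀‖ ^ 2) * fderiv ℝ ψ x (x - x₀)) := by
    intro a ha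
    refine hint.mul_continuous_of_support_subset measurableSet_ball
      ((continuous_const.mul (hg'_cont ha)).mul (hDψc.clm_apply (by fun_prop)))
      (hDψs.mono fun x hx => ?_) fun x hx => ?_
    · intro h
      simp [h] at hx
    · refine hs (tsupport_fderiv_subset ℝ (subset_tsupport _ ?_))
      intro h
      simp [h] at hx
  have hφ_int : ∀ {a : ℝ}, 0 < a →
      Integrable fun x => u x * (radialMollifier E a (‖x - x₀‖ ^ 2) * ψ x) := fun ha =>
    hint.mul_continuous_of_support_subset measurableSet_ball
      ((contDiff_radialMollifier_normSq ha x₀).continuous.mul hψ.continuous)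
      hc.mul_left ((Function.support_mul_subset_right _ _).trans ((subset_tsupport _).trans hs))
  have hsum : ∀ᶠ a in 𝓝[>] (0 : ℝ),
      (∫ x, u x * (g a (‖x - x₀‖ ^ 2) * Δ ψ x))
      + (∫ x, u x * (4 * deriv (g a) (‖x - x₀‖ ^ 2) * fderiv ℝ ψ x (x - x₀)))
      + ((N a)⁻¹ * (∫ x, u x * (radialMollifier E a (‖x - x₀‖ ^ 2) * ψ x))
        - (N a)⁻¹ * ∫ x, u x * (radialMollifier E 1 (‖x - x₀‖ ^ 2) * ψ x)) = 0 := by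
    filter_upwards [hsmall] with a ⟨ha, ha4, hN⟩
    have hw := isWeaklyHarmonicOn_of_laplacian_eq_zero
      (Metric.isOpen_ball.sdiff isClosed_singleton) hu h0
      (fun x => ψ x * g a (‖x - x₀‖ ^ 2))
      (hψ.mul (contDiff_comp_normSq_sub (contDiff_radialCutoff ha) x₀)) hc.mul_right (by
        have hclosed : IsClosed {y : E | a ≤ ‖y - x₀‖ ^ 2} :=
          isClosed_le continuous_const (by fun_prop)
        have h1 : tsupport (fun x => ψ x * g a (‖x - x₀‖ ^ 2)) ⊆ {y : E | a ≤ ‖y - x₀‖ ^ 2} :=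
          closure_minimal (fun y hy => by
            by_contra h
            exact hy (by simp [g, radialCutoff_eq_zero ha (by linarith) hN (not_le.1 h).le])) hclosed
        intro x hx
        refine ⟨hs (tsupport_mul_subset_left hx), fun h => ?_⟩
        have h3 := h1 hx
        rw [mem_singleton_iff.1 h] at h3
        simp at h3
        linarith)
    have hφ_sub : Integrable fun x =>
        (N a)⁻¹ * (u x * (radialMollifier E a (‖x - x₀‖ ^ 2) * ψ x))
          - (N a)⁻¹ * (u x * (radialMollifier E 1 (‖x - x₀‖ ^ 2) * ψ x)) :=
      ((hφ_int ha).const_mul _).sub ((hφ_int one_pos).const_mul _)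
    rw [← integral_add (hA_int ha) (hB_int ha), ← integral_const_mul, ← integral_const_mul,
      ← integral_sub ((hφ_int ha).const_mul _) ((hφ_int one_pos).const_mul _),
      ← integral_add ((hA_int ha).fun_add (hB_int ha))
        hφ_sub, ← hw]
    refine integral_congr_ae (Eventually.of_forall fun x => ?_)
    simp only [g]
    rw [laplacian_mul_comp_normSq_sub hψ2 ((contDiff_radialCutoff ha).of_le h2),
      laplacian_radialCutoff ha]
    simp only [N]
    ring
  have hA : Tendsto (fun a => ∫ x, u x * (g a (‖x - x₀‖ ^ 2) * Δ ψ x)) (𝓝[>] 0)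
      (𝓝 (∫ x, u x * Δ ψ x)) := by
    refine tendsto_integral_filter_of_dominated_convergence (fun x => ‖u x * Δ ψ x‖) ?_ ?_ ?_ ?_
    · filter_upwards [hsmall] with a ha
      exact (hA_int ha.1).aestronglyMeasurable
    · filter_upwards [hsmall] with a ⟨ha, ha4, hN⟩
      refine Eventually.of_forall fun x => ?_
      have e1 := radialCutoff_nonneg ha (by linarith) hN (s := ‖x - x₀‖ ^ 2) (by positivity)
      have e2 := radialCutoff_le_one ha (by linarith) hN (s := ‖x - x₀‖ ^ 2) (by positivity)
      rw [norm_mul, norm_mul, norm_mul, Real.norm_of_nonneg e1]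
      gcongr
      exact mul_le_of_le_one_left (norm_nonneg _) e2
    · exact (hint.mul_continuous_of_support_subset measurableSet_ball hΔψc
        hc.laplacian hΔψs).norm
    · filter_upwards [hae] with x hx
      have hx' : 0 < ‖x - x₀‖ ^ 2 := by
        have := norm_pos_iff.2 (sub_ne_zero.2 hx)
        positivity
      simpa using ((tendsto_radialCutoff hd hx').mul_const (Δ ψ x)).const_mul (u x)
  -- Dominated convergence: pointwise the cross term is `O(1/N(a))`. For a uniform bound, `g'`
  -- vanishes for `ρ² ≤ a`, and for `ρ² > a` the factor `(ρ²)^(1-d/2) ≤ a^(1-d/2) ≤ C N(a)` cancels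
  -- `1/N(a)`, leaving a multiple of `ρ^(1/2-d)`.
  have hB : Tendsto (fun a => ∫ x, u x * (4 * deriv (g a) (‖x - x₀‖ ^ 2)
      * fderiv ℝ ψ x (x - x₀))) (𝓝[>] 0) (𝓝 0) := by
    have hg'0 : ∀ {a s : ℝ}, 0 < a → a ≤ 1 / 4 → s ≤ a → deriv (g a) s = 0 := by
      intro a s ha ha4 hsa
      rw [deriv_radialCutoff ha, smoothStep_div_eq_zero ha hsa,
        smoothStep_div_eq_zero one_pos (by linarith), sub_self, mul_zero, mul_zero]
    have hg' : ∀ {a s : ℝ}, 0 < a → a ≤ 1 / 4 → 0 < N a → 0 < s →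
        ‖deriv (g a) s‖ ≤ (N a)⁻¹ * s ^ (-(D / 2)) := by
      intro a s ha ha4 hN hs
      have e1 : smoothStep (s / 1) ≤ smoothStep (s / a) :=
        monotone_smoothStep (by gcongr; linarith)
      have e2 := smoothStep_le_one (s / a)
      have e3 := smoothStep_nonneg (s / 1)
      have e4 : ‖smoothStep (s / a) - smoothStep (s / 1)‖ ≤ 1 := by
        rw [Real.norm_of_nonneg (by linarith)]
        linarith
      have e5 : 0 < s ^ (-(D / 2)) := by positivity
      rw [deriv_radialCutoff ha, norm_mul, norm_mul, Real.norm_of_nonneg (inv_nonneg.2 hN.le),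
        Real.norm_of_nonneg e5.le]
      gcongr
      exact mul_le_of_le_one_right e5.le e4
    have hz : 𝓝 (0 : ℝ) = 𝓝 (∫ _ : E, (0 : ℝ)) := by simp
    rw [hz]
    refine tendsto_integral_filter_of_dominated_convergence
      ((Metric.ball x₀ r).indicator fun x => 8 * L * C * ‖x - x₀‖ ^ (1 / 2 - D)) ?_ ?_ ?_ ?_
    · filter_upwards [hsmall] with a ha
      exact (hB_int ha.1).aestronglyMeasurable
    · filter_upwards [hsmall, rpow_le_fundamentalProfile_sqrt hd] with a ⟨ha, ha4, hN⟩ hpr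
      filter_upwards [hae] with x hx
      by_cases hxb : x ∈ Metric.ball x₀ r
      · rw [indicator_of_mem hxb]
        have hρ : 0 < ‖x - x₀‖ := norm_pos_iff.2 (sub_ne_zero.2 hx)
        set ρ := ‖x - x₀‖ with hρdef
        rcases le_or_gt (ρ ^ 2) a with h | h
        · rw [hg'0 ha ha4 h]
          simp only [mul_zero, zero_mul, norm_zero]
          positivity
        · have f1 : ‖fderiv ℝ ψ x (x - x₀)‖ ≤ L * ρ :=
            (fderiv ℝ ψ x).le_of_opNorm_le (hL x) _
          have f2 := hg' ha ha4 hN (s := ρ ^ 2) (by positivity)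
          have f3 : (ρ ^ 2) ^ (-(D / 2)) * ρ = (ρ ^ 2) ^ (1 - D / 2) * ρ⁻¹ := by
            rw [sub_eq_add_neg 1, add_comm 1, Real.rpow_add_one (by positivity)]
            field_simp
          have f4 : (ρ ^ 2) ^ (1 - D / 2) ≤ C * N a :=
            (Real.rpow_le_rpow_of_nonpos ha h.le (by linarith)).trans
              (hpr.trans (hCN a ha ha4))
          have f5 : ρ ^ (3 / 2 - D) * ρ⁻¹ = ρ ^ (1 / 2 - D) := by
            rw [← Real.rpow_neg_one, ← Real.rpow_add hρ]
            congr 1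
            ring
          have f6 : |u x| ≤ 2 * ρ ^ (3 / 2 - D) := hbd x hxb hx
          rw [norm_mul, norm_mul, norm_mul, Real.norm_eq_abs (u x), Real.norm_of_nonneg zero_le_four]
          calc |u x| * (4 * ‖deriv (g a) (ρ ^ 2)‖ * ‖fderiv ℝ ψ x (x - x₀)‖)
              ≤ |u x| * (4 * ((N a)⁻¹ * (ρ ^ 2) ^ (-(D / 2))) * (L * ρ)) := by gcongr
            _ = |u x| * (4 * L * (N a)⁻¹ * ((ρ ^ 2) ^ (-(D / 2)) * ρ)) := by ring
            _ = |u x| * (4 * L * (N a)⁻¹ * ((ρ ^ 2) ^ (1 - D / 2) * ρ⁻¹)) := by rw [f3]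
            _ ≤ (2 * ρ ^ (3 / 2 - D)) * (4 * L * (N a)⁻¹ * ((C * N a) * ρ⁻¹)) := by gcongr
            _ = 8 * L * C * (ρ ^ (3 / 2 - D) * ρ⁻¹) := by field_simp; ring
            _ = 8 * L * C * ρ ^ (1 / 2 - D) := by rw [f5]
      · have : fderiv ℝ ψ x = 0 := image_eq_zero_of_notMem_tsupport fun h =>
          hxb (hs (tsupport_fderiv_subset ℝ h))
        simp [hxb, this]
    · rw [integrable_indicator_iff measurableSet_ball]
      exact (integrableOn_ball_norm_sub_rpow (by omega) (by linarith) x₀ r).const_mul _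
    · filter_upwards [hae] with x hx
      have hρ : 0 < ‖x - x₀‖ := norm_pos_iff.2 (sub_ne_zero.2 hx)
      refine squeeze_zero_norm' (a := fun a => (N a)⁻¹ * (‖u x‖ * (4 *
        (‖x - x₀‖ ^ 2) ^ (-(D / 2)) * ‖fderiv ℝ ψ x (x - x₀)‖))) ?_ ?_
      · filter_upwards [hsmall] with a ⟨ha, ha4, hN⟩
        have f2 := hg' ha ha4 hN (s := ‖x - x₀‖ ^ 2) (by positivity)
        rw [norm_mul, norm_mul, norm_mul, Real.norm_of_nonneg zero_le_four]
        calc _ ≤ ‖u x‖ * (4 * ((N a)⁻¹ * (‖x - x₀‖ ^ 2) ^ (-(D / 2)))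
              * ‖fderiv ℝ ψ x (x - x₀)‖) := by gcongr
          _ = _ := by ring
      · simpa using hNinv.mul_const (‖u x‖ * (4 *
          (‖x - x₀‖ ^ 2) ^ (-(D / 2)) * ‖fderiv ℝ ψ x (x - x₀)‖))
  -- This is where the little-o is needed and a big-O would not do: the mollifier lives where `ρ` is
  -- comparable to `√a`, and there `|u| ≤ κ C N(a)` with `κ` arbitrarily small.
  have hφ : Tendsto (fun a => (N a)⁻¹ * ∫ x, u x * (radialMollifier E a (‖x - x₀‖ ^ 2) * ψ x))
      (𝓝[>] 0) (𝓝 0) := by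
    have hm := mollifierMass_pos (E := E)
    rw [Metric.tendsto_nhds]
    intro ε hε
    -- The `+ 1` keeps the denominator positive when `M` or `C` vanishes and makes the final
    -- inequality strict.
    let κ : ℝ := ε / (M * mollifierMass E * C + 1)
    have hK : 0 ≤ M * mollifierMass E * C := by positivity
    have hκ : 0 < κ := div_pos hε (by positivity)
    obtain ⟨δ, hδ, hball⟩ := Metric.eventually_nhds_iff.1 (eventually_nhdsWithin_iff.1 (ho.def hκ))
    filter_upwards [hsmall, Ioo_mem_nhdsGT (show 0 < δ ^ 2 / 2 by positivity)]
      with a ⟨ha, ha4, hN⟩ haδ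
    have hbound : ‖∫ x, u x * (radialMollifier E a (‖x - x₀‖ ^ 2) * ψ x)‖
        ≤ κ * fundamentalProfile (Module.finrank ℝ E) √a * M * mollifierMass E := by
      rw [← integral_radialMollifier ha x₀, ← integral_const_mul]
      refine norm_integral_le_of_norm_le
        (((contDiff_radialMollifier_normSq ha x₀).continuous.integrable_of_hasCompactSupport
          (hasCompactSupport_radialMollifier ha x₀)).const_mul _)
        (Eventually.of_forall fun x => ?_)
      by_cases hx : radialMollifier E a (‖x - x₀‖ ^ 2) = 0
      · simp [hx]
      · have hxa := support_radialMollifier_subset ha x₀ hx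
        have hρa : √a ≤ ‖x - x₀‖ := Real.sqrt_le_iff.2 ⟨norm_nonneg _, hxa.1.le⟩
        have hρ : 0 < ‖x - x₀‖ := (Real.sqrt_pos.2 ha).trans_le hρa
        have hρ1 : ‖x - x₀‖ ≤ 1 := by nlinarith [hxa.2]
        have hρδ : ‖x - x₀‖ < δ :=
          lt_of_pow_lt_pow_left₀ 2 hδ.le (hxa.2.trans (by linarith [haδ.2]))
        have e1 := hball (by rwa [dist_eq_norm]) (sub_ne_zero.1 (norm_pos_iff.1 hρ))
        rw [Real.norm_of_nonneg (fundamentalProfile_nonneg hρ hρ1)] at e1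
        have e2 : ‖u x‖ ≤ κ * fundamentalProfile (Module.finrank ℝ E) √a := by
          refine e1.trans ?_
          gcongr
          exact fundamentalProfile_antitoneOn hd (mem_Ioi.2 (Real.sqrt_pos.2 ha)) (mem_Ioi.2 hρ) hρa
        have e3 := radialMollifier_nonneg E ha (s := ‖x - x₀‖ ^ 2) (by positivity)
        rw [norm_mul, norm_mul, Real.norm_of_nonneg e3]
        calc ‖u x‖ * (radialMollifier E a (‖x - x₀‖ ^ 2) * ‖ψ x‖)
            ≤ (κ * fundamentalProfile (Module.finrank ℝ E) √a)
              * (radialMollifier E a (‖x - x₀‖ ^ 2) * M) := by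
              gcongr
              · exact (norm_nonneg _).trans e2
              · exact hM x
          _ = _ := by ring
    rw [dist_zero_right, norm_mul, Real.norm_of_nonneg (inv_nonneg.2 hN.le)]
    calc (N a)⁻¹ * ‖∫ x, u x * (radialMollifier E a (‖x - x₀‖ ^ 2) * ψ x)‖
        ≤ (N a)⁻¹ * (κ * (C * N a) * M * mollifierMass E) := by
          gcongr
          refine hbound.trans ?_
          gcongr
          exact hCN a ha ha4
      _ = κ * (M * mollifierMass E * C) := by field_simp
      _ < κ * (M * mollifierMass E * C + 1) := by gcongr; linarith
      _ = ε := by simp only [κ]; field_simp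
  have hlim := (hA.add hB).add (hφ.sub (hNinv.mul_const
    (∫ x, u x * (radialMollifier E 1 (‖x - x₀‖ ^ 2) * ψ x))))
  have := tendsto_nhds_unique (hlim.congr' hsum) tendsto_const_nhds
  simpa using this

end RemovableSingularity

/-! ### Induction on the order of the equation. -/

section Extension

variable {E : Type*} [NormedAddCommGroup E] [InnerProductSpace ℝ E] [FiniteDimensional ℝ E]

theorem ContDiffOn.iterate_laplacian_of_isOpen {f : E → ℝ} {U : Set E} (hU : IsOpen U) {k r : ℕ}
    (hf : ContDiffOn ℝ ((2 * k + r : ℕ) : ℕ∞) f U) :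
    ContDiffOn ℝ ((r : ℕ) : ℕ∞) (Laplacian.laplacian^[k] f) U := by
  induction k generalizing f with
  | zero => simpa using hf
  | succ k ih =>
    refine ih (ContDiffOn.laplacian_of_isOpen hU (hf.of_le ?_))
    rw [show 2 * (k + 1) + r = 2 * k + r + 2 by ring]
    exact le_of_eq rfl

theorem iterate_laplacian_sub_eqOn {f g : E → ℝ} {U : Set E} (hU : IsOpen U) {k : ℕ}
    (hf : ContDiffOn ℝ ((2 * k : ℕ) : ℕ∞) f U) (hg : ContDiffOn ℝ ((2 * k : ℕ) : ℕ∞) g U) :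
    EqOn (Laplacian.laplacian^[k] (f - g))
      (Laplacian.laplacian^[k] f - Laplacian.laplacian^[k] g) U := by
  induction k with
  | zero => exact fun x _ => rfl
  | succ k ih =>
    intro x hx
    have hle : (((2 * k : ℕ) : ℕ∞) : ℕ∞ω) ≤ ((2 * (k + 1) : ℕ) : ℕ∞) := by
      exact_mod_cast (show 2 * k ≤ 2 * (k + 1) by omega)
    have e := (ih (hf.of_le hle) (hg.of_le hle)).eventuallyEq_of_mem (hU.mem_nhds hx)
    have hf2 := (ContDiffOn.iterate_laplacian_of_isOpen (r := 2) hU hf).contDiffAt (hU.mem_nhds hx)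
    have hg2 := (ContDiffOn.iterate_laplacian_of_isOpen (r := 2) hU hg).contDiffAt (hU.mem_nhds hx)
    simp only [Function.iterate_succ_apply', Pi.sub_apply]
    rw [(laplacian_congr_nhds e).eq_of_nhds]
    exact ContDiffAt.laplacian_sub hf2 hg2

theorem isLittleO_fundamentalProfile_of_continuousAt {d : ℕ} (hd : 2 ≤ d) {f : E → ℝ} {x₀ : E}
    (hf : ContinuousAt f x₀) :
    f =o[𝓝[≠] x₀] fun x => fundamentalProfile d ‖x - x₀‖ := by
  have h1 : f =O[𝓝[≠] x₀] fun _ => (1 : ℝ) := (hf.isBigO_one ℝ).mono nhdsWithin_le_nhds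
  refine h1.trans_isLittleO ((isLittleO_const_left_of_ne one_ne_zero).2 ?_)
  have ht : Tendsto (fun x : E => ‖x - x₀‖) (𝓝[≠] x₀) (𝓝[>] 0) := tendsto_norm_sub_self_nhdsNE x₀
  exact tendsto_norm_atTop_atTop.comp ((tendsto_fundamentalProfile hd).comp ht)

variable [MeasurableSpace E] [BorelSpace E]

theorem exists_isWeaklyHarmonicOn_ball_of_isLittleO (hd : 2 ≤ Module.finrank ℝ E) {u : E → ℝ}
    {x₀ : E} {R : ℝ} (hR : 0 < R) (hu : ContDiffOn ℝ 2 u (Metric.ball x₀ R \ {x₀}))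
    (h0 : ∀ x ∈ Metric.ball x₀ R \ {x₀}, Δ u x = 0)
    (ho : u =o[𝓝[≠] x₀] fun x => fundamentalProfile (Module.finrank ℝ E) ‖x - x₀‖) :
    ∃ r, 0 < r ∧ r ≤ R ∧ IntegrableOn u (Metric.ball x₀ r) ∧
      IsWeaklyHarmonicOn u (Metric.ball x₀ r) := by
  have : Nontrivial E := Module.nontrivial_of_finrank_pos (R := ℝ) (by omega)
  obtain ⟨δ, hδ, hball⟩ :=
    Metric.eventually_nhds_iff.1 (eventually_nhdsWithin_iff.1 (ho.def one_pos))
  -- Radius at most `1` keeps the profile nonnegative, so its norm can be dropped, and makes the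
  -- power bound available.
  let r := min R (min δ 1)
  have hr : 0 < r := lt_min hR (lt_min hδ one_pos)
  have hrR : r ≤ R := min_le_left _ _
  have hrδ : r ≤ δ := (min_le_right _ _).trans (min_le_left _ _)
  have hr1 : r ≤ 1 := (min_le_right _ _).trans (min_le_right _ _)
  have hsub : Metric.ball x₀ r \ {x₀} ⊆ Metric.ball x₀ R \ {x₀} :=
    sdiff_subset_sdiff_left (Metric.ball_subset_ball hrR)
  have hbd : ∀ x ∈ Metric.ball x₀ r, x ≠ x₀ →
      |u x| ≤ 2 * ‖x - x₀‖ ^ (3 / 2 - Module.finrank ℝ E : ℝ) := by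
    intro x hx hne
    have hρ : 0 < ‖x - x₀‖ := norm_pos_iff.2 (sub_ne_zero.2 hne)
    have hρr : ‖x - x₀‖ < r := by rwa [← dist_eq_norm]
    have h1 := hball (hx.trans_le hrδ) hne
    rw [one_mul, Real.norm_of_nonneg (fundamentalProfile_nonneg hρ (hρr.le.trans hr1))] at h1
    exact h1.trans (fundamentalProfile_le_rpow hd hρ (hρr.le.trans hr1))
  have hint : IntegrableOn u (Metric.ball x₀ r) := by
    have hdiff : (Metric.ball x₀ r \ {x₀} : Set E) =ᵐ[volume] Metric.ball x₀ r :=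
      sdiff_null_ae_eq_self (by simp)
    refine IntegrableOn.congr_set_ae ?_ hdiff.symm
    have hmeas : MeasurableSet (Metric.ball x₀ r \ {x₀}) :=
      measurableSet_ball.diff (measurableSet_singleton x₀)
    have hrpow : IntegrableOn (fun x => ‖x - x₀‖ ^ (3 / 2 - Module.finrank ℝ E : ℝ))
        (Metric.ball x₀ r \ {x₀}) :=
      (integrableOn_ball_norm_sub_rpow (by omega) (by linarith) x₀ r).mono_set sdiff_subset
    refine Integrable.mono' (hrpow.const_mul 2)
      ((hu.continuousOn.mono hsub).aestronglyMeasurable hmeas) ?_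
    filter_upwards [ae_restrict_mem hmeas] with x hx
    exact hbd x hx.1 hx.2
  exact ⟨r, hr, hrR, hint, isWeaklyHarmonicOn_ball_of_isLittleO hd (hu.mono hsub)
    (fun x hx => h0 x (hsub hx)) ho hint hbd⟩

/-- Subtracting a smooth `P` that carries the top Laplacian of `u` lowers the order by one. Starting
from order zero, where the equation says `u = 0`, avoids a separate harmonic case. -/
theorem exists_contDiff_extension_of_isLittleO (hd : 2 ≤ Module.finrank ℝ E) {x₀ : E} {m : ℕ}
    {u : E → ℝ} {R : ℝ} (hR : 0 < R)
    (hu : ContDiffOn ℝ ((2 * m : ℕ) : ℕ∞) u (Metric.ball x₀ R \ {x₀}))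
    (h0 : ∀ x ∈ Metric.ball x₀ R \ {x₀}, (Laplacian.laplacian^[m] u) x = 0)
    (ho : ∀ k < m, (Laplacian.laplacian^[k] u) =o[𝓝[≠] x₀]
      fun x => fundamentalProfile (Module.finrank ℝ E) ‖x - x₀‖) :
    ∃ δ > 0, ∃ v : E → ℝ, ContDiff ℝ ∞ v ∧ ∀ x ∈ Metric.ball x₀ δ \ {x₀}, u x = v x := by
  have : Nontrivial E := Module.nontrivial_of_finrank_pos (R := ℝ) (by omega)
  induction m generalizing u R with
  | zero => exact ⟨R, hR, fun _ => 0, contDiff_const, h0⟩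
  | succ m ih =>
    have hopen : ∀ r, IsOpen (Metric.ball x₀ r \ {x₀}) := fun r =>
      Metric.isOpen_ball.sdiff isClosed_singleton
    have hw : ContDiffOn ℝ 2 (Laplacian.laplacian^[m] u) (Metric.ball x₀ R \ {x₀}) :=
      ContDiffOn.iterate_laplacian_of_isOpen (r := 2) (hopen R) hu
    obtain ⟨r, hr, hrR, hint, hweak⟩ := exists_isWeaklyHarmonicOn_ball_of_isLittleO hd hR hw
      (fun x hx => by rw [← h0 x hx, Function.iterate_succ_apply']) (ho m (by omega))
    obtain ⟨P, hP, hPm⟩ :=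
      exists_iterate_laplacian_eq_of_isWeaklyHarmonicOn (half_lt_self hr) hint hweak m
    have hsub : Metric.ball x₀ (r / 2) \ {x₀} ⊆ Metric.ball x₀ R \ {x₀} :=
      sdiff_subset_sdiff_left (Metric.ball_subset_ball (by linarith))
    have hPk : ∀ k : ℕ, ContDiffOn ℝ ((2 * k : ℕ) : ℕ∞) P (Metric.ball x₀ (r / 2) \ {x₀}) :=
      fun k => (hP.of_le (by exact_mod_cast le_top)).contDiffOn
    have huk : ∀ k ≤ m, ContDiffOn ℝ ((2 * k : ℕ) : ℕ∞) u (Metric.ball x₀ (r / 2) \ {x₀}) :=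
      fun k hk => (hu.mono hsub).of_le
        (by exact_mod_cast (show 2 * k ≤ 2 * (m + 1) by omega))
    have hlap : ∀ k ≤ m, EqOn (Laplacian.laplacian^[k] (u - P))
        (Laplacian.laplacian^[k] u - Laplacian.laplacian^[k] P)
        (Metric.ball x₀ (r / 2) \ {x₀}) := fun k hk =>
      iterate_laplacian_sub_eqOn (hopen _) (huk k hk) (hPk k)
    obtain ⟨δ, hδ, v, hv, hvu⟩ := ih (u := u - P) (R := r / 2) (by positivity)
      ((huk m le_rfl).sub (hPk m))
      (fun x hx => by
        rw [hlap m le_rfl hx, Pi.sub_apply,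
          hPm x hx.1 ((hw.contDiffAt ((hopen R).mem_nhds (hsub hx))).continuousAt), sub_self])
      (fun k hk => by
        -- The Laplacians of `P` are continuous at `x₀`, hence negligible against the unbounded
        -- profile, so the growth condition passes to `u - P`.
        have h1 := (ho k (by omega)).sub (isLittleO_fundamentalProfile_of_continuousAt hd
          (hP.iterate_laplacian k).continuous.continuousAt)
        refine h1.congr' ?_ EventuallyEq.rfl
        filter_upwards [sdiff_mem_nhdsWithin_compl (Metric.ball_mem_nhds x₀ (half_pos hr)) {x₀}]
          with x hx
        exact (hlap k hk.le hx).symm)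
    refine ⟨δ, hδ, v + P, hv.add hP, fun x hx => ?_⟩
    rw [Pi.add_apply, ← hvu x hx, Pi.sub_apply, sub_add_cancel]

end Extension

/-! ### The equivalence. -/

theorem theorem1 (m n : ℕ) (hm : 2 ≤ m) (hn : 2 ≤ n)
    (Ω : Set (EuclideanSpace ℝ (Fin n))) (hΩ_open : IsOpen Ω) (hΩ_conn : IsConnected Ω)
    (x₀ : EuclideanSpace ℝ (Fin n)) (hx₀ : x₀ ∈ Ω)
    (u : EuclideanSpace ℝ (Fin n) → ℝ) (hu : IsPolyharmonicOn m u (Ω \ {x₀})) :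
    HasRemovableSingularity m u Ω x₀ ↔
      ((3 ≤ n → ∀ k : ℕ, k ≤ m - 1 →
          (fun x => |iteratedLaplacian k u x|) =o[𝓝[≠] x₀]
            (fun x => ‖x - x₀‖ ^ (2 - (n : ℤ)))) ∧
        (n = 2 → ∀ k : ℕ, k ≤ m - 1 →
          (fun x => |iteratedLaplacian k u x|) =o[𝓝[≠] x₀]
            (fun x => Real.log (1 / ‖x - x₀‖)))) := by
  have hfin : Module.finrank ℝ (EuclideanSpace ℝ (Fin n)) = n := finrank_euclideanSpace_fin
  have hgrowth : ((3 ≤ n → ∀ k : ℕ, k ≤ m - 1 →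
          (fun x => |iteratedLaplacian k u x|) =o[𝓝[≠] x₀]
            (fun x => ‖x - x₀‖ ^ (2 - (n : ℤ)))) ∧
        (n = 2 → ∀ k : ℕ, k ≤ m - 1 →
          (fun x => |iteratedLaplacian k u x|) =o[𝓝[≠] x₀]
            (fun x => Real.log (1 / ‖x - x₀‖)))) ↔
      ∀ k < m, (Laplacian.laplacian^[k] u) =o[𝓝[≠] x₀]
        fun x => fundamentalProfile n ‖x - x₀‖ := by
    -- The natural subtraction is harmless because `m` is positive.
    have hk : ∀ k, k ≤ m - 1 ↔ k < m := fun k => by omega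
    simp only [hk, iteratedLaplacian, isLittleO_abs_left]
    rcases eq_or_ne n 2 with h | h
    · simp [fundamentalProfile, h]
    · have h3 : 3 ≤ n := by omega
      simp [fundamentalProfile, h, h3]
  rw [hgrowth]
  constructor
  · rintro ⟨δ, hδ, -, v, hv, -, huv⟩ k -
    have hvk : ContDiffOn ℝ ((0 : ℕ) : ℕ∞) (Laplacian.laplacian^[k] v) (Metric.ball x₀ δ) :=
      ContDiffOn.iterate_laplacian_of_isOpen Metric.isOpen_ball
        (hv.of_le (by exact_mod_cast le_top))
    have hcont := (hvk.contDiffAt (Metric.ball_mem_nhds x₀ hδ)).continuousAt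
    refine (isLittleO_fundamentalProfile_of_continuousAt hn hcont).congr' ?_ EventuallyEq.rfl
    filter_upwards [sdiff_mem_nhdsWithin_compl (Metric.ball_mem_nhds x₀ hδ) {x₀}] with x hx
    have hopen : IsOpen (Metric.ball x₀ δ \ {x₀}) := Metric.isOpen_ball.sdiff isClosed_singleton
    refine (iterate_laplacian_congr_nhds (?_ : v =ᶠ[𝓝 x] u) k).eq_of_nhds
    filter_upwards [hopen.mem_nhds hx] with y hy
    exact (huv y (norm_pos_iff.2 (sub_ne_zero.2 hy.2)) (by rw [← dist_eq_norm]; exact hy.1)).symm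
  · intro ho
    obtain ⟨R, hR, hRΩ⟩ := Metric.isOpen_iff.1 hΩ_open x₀ hx₀
    have hsub : Metric.ball x₀ R \ {x₀} ⊆ Ω \ {x₀} := sdiff_subset_sdiff_left hRΩ
    obtain ⟨δ, hδ, v, hv, huv⟩ := exists_contDiff_extension_of_isLittleO (by rwa [hfin]) hR
      (hu.1.mono hsub) (fun x hx => hu.2 x (hsub hx)) (by rwa [hfin])
    let r := min δ (R / 2)
    have hr : 0 < r := lt_min hδ (half_pos hR)
    -- Half of `R`, so that the closed ball, and not only the open one, lies in `Ω`.
    have hrR : r ≤ R / 2 := min_le_right _ _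
    have huv' : ∀ x ∈ Metric.ball x₀ r \ {x₀}, u x = v x := fun x hx =>
      huv x ⟨Metric.ball_subset_ball (min_le_left _ _) hx.1, hx.2⟩
    have hopen : IsOpen (Metric.ball x₀ r \ {x₀}) := Metric.isOpen_ball.sdiff isClosed_singleton
    have hzero : ∀ x ∈ Metric.ball x₀ r \ {x₀}, (Laplacian.laplacian^[m] v) x = 0 := by
      intro x hx
      have e : v =ᶠ[𝓝 x] u := by
        filter_upwards [hopen.mem_nhds hx] with y hy
        exact (huv' y hy).symm
      rw [(iterate_laplacian_congr_nhds e m).eq_of_nhds]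
      exact hu.2 x (hsub ⟨Metric.ball_subset_ball (by linarith) hx.1, hx.2⟩)
    have hcont : Continuous (Laplacian.laplacian^[m] v) := (hv.iterate_laplacian m).continuous
    have : Nontrivial (EuclideanSpace ℝ (Fin n)) :=
      Module.nontrivial_of_finrank_pos (R := ℝ) (by omega)
    -- The equation at the center itself follows by continuity; nontriviality of the space makes
    -- `x₀` a limit of other points.
    have hzero₀ : (Laplacian.laplacian^[m] v) x₀ = 0 := by
      refine tendsto_nhds_unique (hcont.continuousAt.mono_left (nhdsWithin_le_nhds (s := {x₀}ᶜ)))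
        (tendsto_const_nhds.congr' ?_)
      filter_upwards [sdiff_mem_nhdsWithin_compl (Metric.ball_mem_nhds x₀ hr) {x₀}] with x hx
      exact (hzero x hx).symm
    refine ⟨r, hr, ?_, v, hv.contDiffOn, ⟨(hv.of_le (by exact_mod_cast le_top)).contDiffOn,
      fun x hx => ?_⟩, fun x h1 h2 => huv' x ⟨?_, ?_⟩⟩
    · exact Metric.closure_ball_subset_closedBall.trans
        ((Metric.closedBall_subset_ball (by linarith)).trans hRΩ)
    · by_cases h : x = x₀
      · rw [h]
        exact hzero₀
      · exact hzero x ⟨hx, h⟩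
    · rwa [Metric.mem_ball, dist_eq_norm]
    · exact sub_ne_zero.1 (norm_pos_iff.1 h1)
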